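/- **Theorem 1.1 (Existence).** Let $T>0$, $d\in\mathbb N$, $c\in\mathbb R^d$, and let $b:[0,T]\times\mathbb R^d\to\mathbb R^d$, $\sigma_1,\dots,\sigma_d:[0,T]\to\mathbb R$ be such that $b$ and its first spatial derivatives $\partial_{x_1}b,\dots,\partial_{x_d}b$ exist and are bounded and continuous on $[0,T]\times\mathbb R^d$, and the $\sigma_i$ are bounded and continuous. Let $\Omega=C([0,T];\mathbb R^d)$ with the Wiener measure $\mathbb P$ and coordinate process $B(t)(\omega)=\omega(t)$. Let $\pi=\{0=t_0<t_1<\dots<t_N=T\}$ be any finite partition, $h_k=t_{k+1}-t_k$ (so $h_k=T/N$ for an equally spaced partition), and let $B^\pi$ be the piecewise linear interpolation of $B$ at the points of $\pi$. For $0\le s\le t\le T$ put $$\mathcal E_i^\pi(s,t)=\exp\Big(\int_s^t\sigma_i(r)\dot B_i^\pi(r)\,dr-\tfrac12\mathbb E\Big[\Big(\int_s^t\sigma_i(r)\dot B_i^\pi(r)\,dr\Big)^2\Big]\Big),$$ and for a random variable $Y$ on $\Omega$ define the Wick product $$(Y\diamond\mathcal E_i^\pi(s,t))(\omega)=Y\Big(\omega-e_i\sum_{k=0}^{N-1}\frac1{h_k}\Big(\int_{[s,t]\cap[t_k,t_{k+1}]}\sigma_i(r)\,dr\Big)\int_0^{\cdot}\mathbf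 1_{[t_k,t_{k+1}]}(r)\,dr\Big)\,\mathcal E_i^\pi(s,t)(\omega).$$ Then the Wick–Wong–Zakai system $$\frac{dX_i(t)}{dt}=b_i(t,X(t))+\sigma_i(t)X_i(t)\diamond\frac{dB_i^\pi(t)}{dt},\qquad X_i(0)=c_i,\qquad i=1,\dots,d,$$ has a mild solution on $[0,T]$: there is an $\mathbb R^d$-valued stochastic process $\{X(t)\}_{t\in[0,T]}$ on $\Omega$ such that 1. $t\mapsto X(t)$ is almost surely continuous on $[0,T]$; 2. for some $p>1$, $X_i(t)\in L^p(\Omega)$ for all $i$ and all $t\in[0,T]$; 3. almost surely, for all $t\in[0,T]$ and $i=1,\dots,d$, the integrand below is integrable in $s$ over $[0,t]$ and $$X_i(t)=c_i\,\mathcal E_i^\pi(0,t)+\int_0^t b_i(s,X(s))\diamond\mathcal E_i^\pi(s,t)\,ds.$$ Moreover, $X$ can be chosen of the following form. For every $k\in\{0,\dots,N-1\}$ and $\alpha\in\mathbb R^d$ there is a classical solution $u(\cdot,\cdot;t_k,\alpha)\in C^1([t_k,t_{k+1}]\times\mathbb R^d;\mathbb R^d)$ of $$\partial_tu_i(t,x)=-\sigma_i(t)\,\partial_{x_i}u_i(t,x)+\sigma_i(t)\frac{x_i}{h_k}u_i(t,x)+b_i(t,u(t,x)),\quad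 t\in\,]t_k,t_{k+1}],\ x\in\mathbb R^d,\ i=1,\dots,d,\qquad u(t_k,x)=\alpha,$$ such that $X(0)=c$ and $$X(t)=u\big(t,\,B(t_{k+1})-B(t_k);\,t_k,\,X(t_k)\big),\qquad t\in[t_k,t_{k+1}],\ k=0,\dots,N-1.$$ -/

import Mathlib

open MeasureTheory ProbabilityTheory Set

noncomputable section

namespace WickWZ

variable {d N : ℕ} {T : ℝ}

/-- The path space `C([0,T]; ℝ^d)`. -/
abbrev PathSpace (T : ℝ) (d : ℕ) : Type := C(Icc (0 : ℝ) T, Fin d → ℝ)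

/-- The σ-algebra on path space generated by the coordinate maps `ω ↦ ω(t)`
(it is the Borel σ-algebra of uniform convergence). -/
instance instMeasurableSpacePathSpace : MeasurableSpace (PathSpace T d) :=
  MeasurableSpace.comap (fun (ω : PathSpace T d) (t : Icc (0 : ℝ) T) => ω t) MeasurableSpace.pi

/-- `P` is the Wiener measure on `C([0,T]; ℝ^d)`: under `P` the coordinate process starts at `0`,
has independent increments, and the increment over `[s,t]` is a vector of `d` independent centered
Gaussian variables of variance `t - s`. -/
structure IsWienerMeasure (P : Measure (PathSpace T d)) : Prop where
  prob : IsProbabilityMeasure P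
  start : ∀ t : Icc (0 : ℝ) T, (t : ℝ) = 0 → ∀ᵐ ω ∂P, ω t = 0
  indep : HasIndepIncrements (fun (t : Icc (0 : ℝ) T) (ω : PathSpace T d) => ω t) P
  law : ∀ s t : Icc (0 : ℝ) T, s ≤ t →
    HasLaw (fun ω : PathSpace T d => ω t - ω s)
      (Measure.pi fun _ : Fin d => gaussianReal 0 (Real.toNNReal ((t : ℝ) - s))) P

/-- The coordinate process `B(t)(ω) = ω(t)`, `t ∈ [0,T]` (only times in `[0,T]` are relevant). -/
def B (t : ℝ) (ω : PathSpace T d) : Fin d → ℝ :=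
  open Classical in if h : t ∈ Icc (0 : ℝ) T then ω ⟨t, h⟩ else 0

/-- `0 = t_0 < t_1 < ⋯ < t_N = T`. -/
structure IsPartition (T : ℝ) (τ : Fin (N + 1) → ℝ) : Prop where
  zero : τ 0 = 0
  last : τ (Fin.last N) = T
  strictMono : StrictMono τ

/-- Length of the `k`-th partition interval `[t_k, t_{k+1}]`; it is the mesh `T / N` if the
partition is equally spaced. -/
def len (τ : Fin (N + 1) → ℝ) (k : Fin N) : ℝ := τ k.succ - τ k.castSucc

/-- The polygonal approximation `B^π` of the coordinate process: linear interpolation on each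
`[t_k, t_{k+1})`, and `B^π(T) = B(T)`. -/
def polygonal (τ : Fin (N + 1) → ℝ) (ω : PathSpace T d) (t : ℝ) : Fin d → ℝ :=
  open Classical in
  if t = T then B T ω else
    ∑ k : Fin N, (Ico (τ k.castSucc) (τ k.succ)).indicator
      (fun r => (1 - (r - τ k.castSucc) / len τ k) • B (τ k.castSucc) ω
        + ((r - τ k.castSucc) / len τ k) • B (τ k.succ) ω) t

/-- `∫_s^t σ_i(r) (d/dr) B_i^π(r) dr`. -/
def noiseIntegral (τ : Fin (N + 1) → ℝ) (σ : Fin d → ℝ → ℝ) (i : Fin d) (s t : ℝ)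
    (ω : PathSpace T d) : ℝ :=
  ∫ r in s..t, σ i r * deriv (fun q => polygonal τ ω q i) r

/-- The stochastic exponential
`ℰ_i^π(s,t) = exp(∫_s^t σ_i dB_i^π - ½ 𝔼[(∫_s^t σ_i dB_i^π)²])`. -/
def wickExp (P : Measure (PathSpace T d)) (τ : Fin (N + 1) → ℝ) (σ : Fin d → ℝ → ℝ) (i : Fin d)
    (s t : ℝ) (ω : PathSpace T d) : ℝ :=
  Real.exp (noiseIntegral τ σ i s t ω - (1 / 2) * ∫ ω', (noiseIntegral τ σ i s t ω') ^ 2 ∂P)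

/-- `∫_{[s,t] ∩ [t_k, t_{k+1}]} σ_i(r) dr` (for `s ≤ t`). -/
def sigmaInt (τ : Fin (N + 1) → ℝ) (σ : Fin d → ℝ → ℝ) (i : Fin d) (k : Fin N) (s t : ℝ) : ℝ :=
  ∫ r in s..t, (Icc (τ k.castSucc) (τ k.succ)).indicator (σ i) r

/-- The Cameron–Martin path
`e_i ∑_k (t_{k+1} - t_k)⁻¹ (∫_{[s,t] ∩ [t_k,t_{k+1}]} σ_i) ∫_0^· 1_{[t_k,t_{k+1}]}(r) dr`.
If `[s,t] ⊆ [t_k,t_{k+1}]` only the `k`-th summand is nonzero. -/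
def shift (τ : Fin (N + 1) → ℝ) (σ : Fin d → ℝ → ℝ) (i : Fin d) (s t : ℝ) : PathSpace T d where
  toFun q := Pi.single i (∑ k : Fin N, sigmaInt τ σ i k s t / len τ k *
    ∫ r in (0 : ℝ)..(q : ℝ), (Icc (τ k.castSucc) (τ k.succ)).indicator (fun _ => (1 : ℝ)) r)
  continuous_toFun := by
    refine (continuous_single (A := fun _ : Fin d => ℝ) i).comp
      (continuous_finsetSum _ fun k _ => continuous_const.mul ?_)
    refine (intervalIntegral.continuous_primitive (fun a b => ?_) 0).comp continuous_subtype_val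
    exact ⟨(integrableOn_const (by simp)).indicator measurableSet_Icc,
      (integrableOn_const (by simp)).indicator measurableSet_Icc⟩

/-- The Wick product `Y ◇ ℰ_i^π(s,t)`, that is, `ℰ_i^π(s,t)` times the translate of `Y` along
`shift`. For `[s,t]` inside one partition interval this is the translation formula on that
interval; in general it is the iteration of that formula over the successive partition intervals
met by `[s,t]`. -/
def wickMul (P : Measure (PathSpace T d)) (τ : Fin (N + 1) → ℝ) (σ : Fin d → ℝ → ℝ) (i : Fin d)
    (s t : ℝ) (Y : PathSpace T d → ℝ) (ω : PathSpace T d) : ℝ :=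
  Y (ω - shift τ σ i s t) * wickExp P τ σ i s t ω

/-- `b` and its first order spatial derivatives exist, are bounded and continuous on
`[0,T] × ℝ^d`, and the `σ_i` are bounded and continuous on `[0,T]`. -/
structure RegularCoefficients (T : ℝ) (b : ℝ → (Fin d → ℝ) → Fin d → ℝ) (σ : Fin d → ℝ → ℝ) :
    Prop where
  b_cont : ContinuousOn (fun q : ℝ × (Fin d → ℝ) => b q.1 q.2) (Icc 0 T ×ˢ univ)
  b_bdd : ∃ M : ℝ, ∀ t ∈ Icc 0 T, ∀ x, ‖b t x‖ ≤ M
  b_diff : ∀ j : Fin d, ∀ t ∈ Icc 0 T, ∀ x, LineDifferentiableAt ℝ (b t) x (Pi.single j 1)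
  db_cont : ∀ j : Fin d, ContinuousOn
    (fun q : ℝ × (Fin d → ℝ) => lineDeriv ℝ (b q.1) q.2 (Pi.single j 1)) (Icc 0 T ×ˢ univ)
  db_bdd : ∀ j : Fin d, ∃ M : ℝ, ∀ t ∈ Icc 0 T, ∀ x, ‖lineDeriv ℝ (b t) x (Pi.single j 1)‖ ≤ M
  σ_cont : ∀ i, ContinuousOn (σ i) (Icc 0 T)
  σ_bdd : ∀ i, ∃ M : ℝ, ∀ t ∈ Icc 0 T, |σ i t| ≤ M

/-- `X` is a mild solution of the system
`dX_i/dt = b_i(t,X) + σ_i(t) X_i ◇ dB_i^π/dt`, `X_i(0) = c_i`, on `[0,T]`. -/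
structure IsMildSolution (P : Measure (PathSpace T d)) (τ : Fin (N + 1) → ℝ)
    (b : ℝ → (Fin d → ℝ) → Fin d → ℝ) (σ : Fin d → ℝ → ℝ) (c : Fin d → ℝ)
    (X : ℝ → PathSpace T d → Fin d → ℝ) : Prop where
  measurable : ∀ t ∈ Icc 0 T, Measurable (X t)
  cont : ∀ᵐ ω ∂P, ContinuousOn (fun t => X t ω) (Icc 0 T)
  memLp : ∃ p : ENNReal, 1 < p ∧ ∀ t ∈ Icc 0 T, ∀ i, MemLp (fun ω => X t ω i) p P
  integral_eq : ∀ᵐ ω ∂P, ∀ t ∈ Icc 0 T, ∀ i,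
    IntervalIntegrable (fun s => wickMul P τ σ i s t (fun ω' => b s (X s ω') i) ω) volume 0 t ∧
    X t ω i = c i * wickExp P τ σ i 0 t ω
      + ∫ s in (0 : ℝ)..t, wickMul P τ σ i s t (fun ω' => b s (X s ω') i) ω

/-- `u` is a classical (`C¹`) solution on `[r,R] × ℝ^d` of the semilinear hyperbolic system
`∂_t u_i = -σ_i(t) ∂_{x_i} u_i + σ_i(t) (x_i / h) u_i + b_i(t,u)`, `u(r,·) = α`. -/
structure IsClassicalSolution (b : ℝ → (Fin d → ℝ) → Fin d → ℝ) (σ : Fin d → ℝ → ℝ) (h r R : ℝ)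
    (α : Fin d → ℝ) (u : ℝ → (Fin d → ℝ) → Fin d → ℝ) : Prop where
  contDiffOn : ContDiffOn ℝ 1 (fun q : ℝ × (Fin d → ℝ) => u q.1 q.2) (Icc r R ×ˢ univ)
  initial : ∀ x, u r x = α
  pde : ∀ t ∈ Ioc r R, ∀ x i,
    derivWithin (fun q => u q x i) (Icc r R) t =
      -σ i t * lineDeriv ℝ (fun y => u t y i) x (Pi.single i 1)
        + σ i t * (x i / h) * u t x i + b t (u t x) i

end WickWZ

end

/-!
Everything is deterministic once paths are replaced by their increments `ξ_k = B(t_{k+1}) - B(t_k)`.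
The noise integral is linear in `ξ`, so by the Gaussian law of the increments the stochastic
exponential is an explicit product of weights `exp((ξ_{k,i} a - a²/2)/h_k)` (`wickExp_eq`), and the
Cameron–Martin translation moves `ξ_{k,i}` by `-a`, where `a` is the integral of `σ_i` over
`[s,t] ∩ [t_k,t_{k+1}]` (`increment_sub_shift`). These are the weight and the displacement that the
method of characteristics gives for the hyperbolic system on one partition interval, so the mild
form of that system at `x = ξ_k` is the Wick mild equation on that interval.

The mild form is a system of Volterra equations in which every component is transported along its
own characteristics. It is solved by Picard iteration on cones that contain the domain of dependence
of their points (`VolterraSystem.exists_picard_eq`, `VolterraSystem.eq_of_picard_eq`). The initial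
value `α` is carried as a further space variable, so that the solution is jointly continuous in
`(t,x,α)`, which later gives measurability.

For regularity, a function `f` is `C¹` as soon as `f q - f p = D p q (q - p)` with `D` jointly
continuous, the diagonal included (`contDiff_one_of_hadamard`). Such a `D` has to satisfy a linear
Volterra system on pairs of points, whose coefficients are Hadamard quotients of `b` and of the
weights. That system has a continuous solution, and uniqueness identifies `D p q (q - p)` with
`f q - f p` (`exists_hadamard`). No convergence of the derivatives of the Picard iterates is needed.
Along characteristics the solution is a weight times a primitive in time, which gives the
differentiability in `t` and the differential equation (`contDiff_mild`, `mild_pde`).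

The process is the concatenation of these flows. Its mild equation over several intervals follows by
induction from the multiplicativity of the weights (`state_mild`). It also bounds the process by a
constant times `exp(S ∑_k |ξ_{k,i}|)`, which is in `L²`.
-/

noncomputable section

namespace WickWZ

open Filter Topology

section Volterra

/-! ### Volterra equations with transport -/

/-- Data of the system of Volterra equations
`u_i(t,z) = g_i(t,z) + ∫_r^t G_i(s,t,z,u(s,φ_i(s,t,z))) ds` for a function `u` of time and of a
space variable `z`. Each component is transported by its own flow `φ_i`, of speed at most `S`, and
`G_i` is Lipschitz in the unknown, locally uniformly in `(s,t,z)`. -/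
structure VolterraSystem (ι Z F : Type*) [Fintype ι] [NormedAddCommGroup Z]
    [NormedAddCommGroup F] where
  r : ℝ
  S : ℝ
  φ : ι → ℝ → ℝ → Z → Z
  g : ι → ℝ → Z → F
  G : ι → ℝ → ℝ → Z → (ι → F) → F
  one_le : 1 ≤ S
  continuous_φ : ∀ i, Continuous fun q : ℝ × ℝ × Z => φ i q.1 q.2.1 q.2.2
  norm_φ_le : ∀ i s t z, ‖φ i s t z‖ ≤ ‖z‖ + S * |t - s|
  continuous_g : ∀ i, Continuous fun q : ℝ × Z => g i q.1 q.2
  continuous_G : ∀ i, Continuous fun q : ℝ × ℝ × Z × (ι → F) => G i q.1 q.2.1 q.2.2.1 q.2.2.2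
  lipschitz : ∀ R : ℝ, ∃ K : ℝ, 0 ≤ K ∧ ∀ i s t z p q, |s - r| ≤ R → |t - r| ≤ R → ‖z‖ ≤ R →
    ‖G i s t z p - G i s t z q‖ ≤ K * ‖p - q‖

namespace VolterraSystem

variable {ι Z F : Type*} [Fintype ι] [NormedAddCommGroup Z]
    [NormedAddCommGroup F] (V : VolterraSystem ι Z F)

/-- The truncated double cone around the initial time `r`. It contains the domain of dependence of
each of its points, because it narrows with the maximal propagation speed `S`. -/
def cone (R : ℝ) : Set (ℝ × Z) := {q | ‖q.2‖ + V.S * |q.1 - V.r| ≤ R}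

variable {V}

theorem continuous_integrand {u : ℝ × Z → ι → F} (hu : Continuous u) (i : ι) :
    Continuous fun q : (ℝ × Z) × ℝ =>
      V.G i q.2 q.1.1 q.1.2 (u (q.2, V.φ i q.2 q.1.1 q.1.2)) := by
  have h1 : Continuous fun q : (ℝ × Z) × ℝ => V.φ i q.2 q.1.1 q.1.2 :=
    (V.continuous_φ i).comp (by fun_prop : Continuous fun q : (ℝ × Z) × ℝ => (q.2, q.1.1, q.1.2))
  exact (V.continuous_G i).comp (continuous_snd.prodMk
    ((continuous_fst.comp continuous_fst).prodMk
      ((continuous_snd.comp continuous_fst).prodMk (hu.comp (continuous_snd.prodMk h1)))))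

theorem mem_cone_of_mem_uIoc {R : ℝ} {q : ℝ × Z} (hq : q ∈ V.cone R) {s : ℝ}
    (hs : s ∈ uIoc V.r q.1) (i : ι) :
    (s, V.φ i s q.1 q.2) ∈ V.cone R ∧ |s - V.r| ≤ R ∧ |q.1 - V.r| ≤ R ∧ ‖q.2‖ ≤ R := by
  have h1 := V.norm_φ_le i s q.1 q.2
  have h2 : |q.1 - s| + |s - V.r| = |q.1 - V.r| := by
    rcases le_total V.r q.1 with h | h
    · rw [uIoc_of_le h] at hs
      rw [abs_of_nonneg (by linarith [hs.2]), abs_of_nonneg (by linarith [hs.1]),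
        abs_of_nonneg (by linarith)]
      ring
    · rw [uIoc_of_ge h] at hs
      rw [abs_of_nonpos (by linarith [hs.1]), abs_of_nonpos (by linarith [hs.2]),
        abs_of_nonpos (by linarith)]
      ring
  have hq' : ‖q.2‖ + V.S * |q.1 - V.r| ≤ R := hq
  have hS := V.one_le
  have h3 := abs_nonneg (q.1 - s)
  have h4 := abs_nonneg (s - V.r)
  have h5 := norm_nonneg q.2
  have h6 : |q.1 - V.r| ≤ V.S * |q.1 - V.r| := by
    nlinarith [abs_nonneg (q.1 - V.r)]
  refine ⟨?_, by linarith, by linarith, ?_⟩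
  · change ‖V.φ i s q.1 q.2‖ + V.S * |s - V.r| ≤ R
    rw [← h2] at hq'
    linarith
  · linarith [abs_nonneg (q.1 - V.r)]

theorem abs_sub_le_of_mem_cone {R : ℝ} {q : ℝ × Z} (hq : q ∈ V.cone R) : |q.1 - V.r| ≤ R := by
  have hq' : ‖q.2‖ + V.S * |q.1 - V.r| ≤ R := hq
  nlinarith [V.one_le, norm_nonneg q.2, abs_nonneg (q.1 - V.r)]

theorem cone_mem_nhds (q : ℝ × Z) : ∃ R, V.cone R ∈ 𝓝 q := by
  have hc : Continuous fun q : ℝ × Z => ‖q.2‖ + V.S * |q.1 - V.r| := by fun_prop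
  refine ⟨‖q.2‖ + V.S * |q.1 - V.r| + 1, ?_⟩
  filter_upwards [hc.continuousAt.eventually (gt_mem_nhds (lt_add_one _))] with p hp
  exact hp.le

theorem intervalIntegrable_integrand {u : ℝ × Z → ι → F} (hu : Continuous u) (i : ι) (q : ℝ × Z)
    (a b : ℝ) :
    IntervalIntegrable (fun s => V.G i s q.1 q.2 (u (s, V.φ i s q.1 q.2))) volume a b :=
  ((continuous_integrand hu i).comp (continuous_const.prodMk continuous_id)).intervalIntegrable a b

theorem isCompact_cone [ProperSpace Z] (R : ℝ) : IsCompact (V.cone R) := by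
  refine Metric.isCompact_of_isClosed_isBounded ?_ ?_
  · exact isClosed_le (by fun_prop) continuous_const
  · refine (Bornology.IsBounded.prod (Metric.isBounded_closedBall (x := V.r) (r := R))
      (Metric.isBounded_closedBall (x := (0 : Z)) (r := R))).subset fun q hq => ⟨?_, ?_⟩
    · simpa [Real.dist_eq] using abs_sub_le_of_mem_cone hq
    · have hq' : ‖q.2‖ + V.S * |q.1 - V.r| ≤ R := hq
      have := mul_nonneg (zero_le_one.trans V.one_le) (abs_nonneg (q.1 - V.r))
      simpa using by linarith

theorem exists_norm_sub_le [ProperSpace Z] {u v : ℝ × Z → ι → F} (hu : Continuous u)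
    (hv : Continuous v) (R : ℝ) :
    ∃ C, 0 ≤ C ∧ ∀ q ∈ V.cone R, ‖u q - v q‖ ≤ C := by
  obtain ⟨C, hC⟩ := (V.isCompact_cone R).exists_bound_of_continuousOn (hu.sub hv).continuousOn
  exact ⟨max C 0, le_max_right _ _, fun q hq => (hC q hq).trans (le_max_left _ _)⟩

section Picard

variable [NormedSpace ℝ F]

variable (V) in
/-- The Picard map, whose fixed points are the solutions of the system. -/
def picard (u : ℝ × Z → ι → F) (q : ℝ × Z) (i : ι) : F :=
  V.g i q.1 q.2 + ∫ s in V.r..q.1, V.G i s q.1 q.2 (u (s, V.φ i s q.1 q.2))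

theorem continuous_picard {u : ℝ × Z → ι → F} (hu : Continuous u) : Continuous (V.picard u) := by
  refine continuous_pi fun i => (V.continuous_g i).add ?_
  exact intervalIntegral.continuous_parametric_intervalIntegral_of_continuous
    (f := fun (q : ℝ × Z) s => V.G i s q.1 q.2 (u (s, V.φ i s q.1 q.2)))
    (continuous_integrand hu i) continuous_fst

/-- One Picard step gains a factor `K |t - r| / (n + 1)` on the cone, as for ordinary differential
equations, because the domain of dependence of a point of the cone stays in the cone. -/
theorem norm_picard_sub_le {R K : ℝ} (hK : ∀ i s t z p q, |s - V.r| ≤ R → |t - V.r| ≤ R →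
      ‖z‖ ≤ R → ‖V.G i s t z p - V.G i s t z q‖ ≤ K * ‖p - q‖) (hK0 : 0 ≤ K)
    {u v : ℝ × Z → ι → F} (hu : Continuous u) (hv : Continuous v) {C : ℝ} (hC : 0 ≤ C) (n : ℕ)
    (h : ∀ q ∈ V.cone R, ‖u q - v q‖ ≤ C * ((K * |q.1 - V.r|) ^ n / n.factorial))
    {q : ℝ × Z} (hq : q ∈ V.cone R) :
    ‖V.picard u q - V.picard v q‖
      ≤ C * ((K * |q.1 - V.r|) ^ (n + 1) / (n + 1).factorial) := by
  refine (pi_norm_le_iff_of_nonneg (by positivity)).2 fun i => ?_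
  have e : (V.picard u q - V.picard v q) i = ∫ s in V.r..q.1,
      (V.G i s q.1 q.2 (u (s, V.φ i s q.1 q.2)) - V.G i s q.1 q.2 (v (s, V.φ i s q.1 q.2))) := by
    rw [intervalIntegral.integral_sub (intervalIntegrable_integrand hu i q _ _)
      (intervalIntegrable_integrand hv i q _ _)]
    simp [picard]
  rw [e]
  have hb : ∀ s ∈ uIoc V.r q.1,
      ‖V.G i s q.1 q.2 (u (s, V.φ i s q.1 q.2)) - V.G i s q.1 q.2 (v (s, V.φ i s q.1 q.2))‖
        ≤ (C * K ^ (n + 1) / n.factorial) * |s - V.r| ^ n := by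
    intro s hs
    obtain ⟨h1, h2, h3, h4⟩ := mem_cone_of_mem_uIoc hq hs i
    refine (hK i s q.1 q.2 _ _ h2 h3 h4).trans ((mul_le_mul_of_nonneg_left (h _ h1) hK0).trans ?_)
    rw [mul_pow, pow_succ]
    apply le_of_eq
    ring
  refine (intervalIntegral.norm_integral_le_abs_of_norm_le
    ((ae_restrict_iff' measurableSet_uIoc).2 (ae_of_all _ hb)) ?_).trans ?_
  · exact Continuous.intervalIntegrable (by fun_prop) _ _
  · rw [intervalIntegral.integral_const_mul, abs_mul, intervalIntegral.abs_intervalIntegral_eq,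
      integral_pow_abs_sub_uIoc, abs_of_nonneg (by positivity), abs_of_nonneg (by positivity),
      Nat.factorial_succ, mul_pow]
    apply le_of_eq
    push_cast
    field_simp

theorem norm_picard_iterate_sub_le {R K : ℝ}
    (hK : ∀ i s t z p q, |s - V.r| ≤ R → |t - V.r| ≤ R →
      ‖z‖ ≤ R → ‖V.G i s t z p - V.G i s t z q‖ ≤ K * ‖p - q‖) (hK0 : 0 ≤ K)
    {u v : ℝ × Z → ι → F} (hu : Continuous u) (hv : Continuous v) {C : ℝ} (hC : 0 ≤ C)
    (h : ∀ q ∈ V.cone R, ‖u q - v q‖ ≤ C) (n : ℕ) :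
    Continuous (V.picard^[n] u) ∧ Continuous (V.picard^[n] v) ∧
    ∀ q ∈ V.cone R, ‖V.picard^[n] u q - V.picard^[n] v q‖
      ≤ C * ((K * |q.1 - V.r|) ^ n / n.factorial) := by
  induction n with
  | zero => exact ⟨hu, hv, by simpa using h⟩
  | succ n ih =>
    simp only [Function.iterate_succ_apply']
    exact ⟨continuous_picard ih.1, continuous_picard ih.2.1,
      fun q hq => norm_picard_sub_le hK hK0 ih.1 ih.2.1 hC n ih.2.2 hq⟩

variable [ProperSpace Z]

theorem eq_of_picard_eq {u v : ℝ × Z → ι → F} (hu : Continuous u) (hv : Continuous v)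
    (hu' : V.picard u = u) (hv' : V.picard v = v) : u = v := by
  funext q
  obtain ⟨R, hR⟩ := V.cone_mem_nhds q
  obtain ⟨K, hK0, hK⟩ := V.lipschitz R
  obtain ⟨C, hC0, hC⟩ := V.exists_norm_sub_le hu hv R
  have h : ∀ n : ℕ, ‖u q - v q‖ ≤ C * ((K * |q.1 - V.r|) ^ n / n.factorial) := fun n => by
    have := (norm_picard_iterate_sub_le hK hK0 hu hv hC0 hC n).2.2 q (mem_of_mem_nhds hR)
    rwa [Function.iterate_fixed hu', Function.iterate_fixed hv'] at this
  have h0 := ((Real.summable_pow_div_factorial (K * |q.1 - V.r|)).tendsto_atTop_zero).const_mul C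
  rw [mul_zero] at h0
  exact sub_eq_zero.1 (norm_le_zero_iff.1 (ge_of_tendsto' h0 h))

variable [CompleteSpace F]

theorem exists_picard_eq (V : VolterraSystem ι Z F) :
    ∃ u : ℝ × Z → ι → F, Continuous u ∧ V.picard u = u := by
  set a : ℕ → ℝ × Z → ι → F := fun n => V.picard^[n] 0 with ha
  have ha_succ : ∀ n, a (n + 1) = V.picard (a n) := fun n => Function.iterate_succ_apply' _ _ _
  have ha_cont : ∀ n, Continuous (a n) := by
    intro n
    induction n with
    | zero => exact continuous_const
    | succ n ih => rw [ha_succ]; exact continuous_picard ih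
  have hbound : ∀ R, ∃ w : ℕ → ℝ, Summable w ∧
      ∀ n, ∀ q ∈ V.cone R, ‖a (n + 1) q - a n q‖ ≤ w n := by
    intro R
    obtain ⟨K, hK0, hK⟩ := V.lipschitz R
    obtain ⟨C, hC0, hC⟩ := V.exists_norm_sub_le (ha_cont 1) (ha_cont 0) R
    refine ⟨fun n => C * ((K * R) ^ n / n.factorial),
      (Real.summable_pow_div_factorial _).mul_left C, fun n q hq => ?_⟩
    have := (norm_picard_iterate_sub_le hK hK0 (ha_cont 1) (ha_cont 0) hC0 hC n).2.2 q hq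
    have e : V.picard^[n] (a 1) = a (n + 1) := (Function.iterate_add_apply _ n 1 0).symm
    rw [e] at this
    refine this.trans ?_
    have := abs_sub_le_of_mem_cone hq
    change _ ≤ C * ((K * R) ^ n / n.factorial)
    gcongr
  set u : ℝ × Z → ι → F := fun q => ∑' n, (a (n + 1) q - a n q) with hu
  have hpart : ∀ n q, ∑ k ∈ Finset.range n, (a (k + 1) q - a k q) = a n q := fun n q => by
    rw [Finset.sum_range_sub (fun k => a k q)]
    simp [ha]
  have hunif : ∀ R, TendstoUniformlyOn a u atTop (V.cone R) := by
    intro R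
    obtain ⟨w, hw, hw'⟩ := hbound R
    have := tendstoUniformlyOn_tsum_nat hw hw'
    simpa only [hpart] using this
  have hu_cont : Continuous u := by
    refine continuous_iff_continuousAt.2 fun q => ?_
    obtain ⟨R, hR⟩ := V.cone_mem_nhds q
    exact ((hunif R).continuousOn
      (Frequently.of_forall fun n => (ha_cont n).continuousOn)).continuousAt hR
  refine ⟨u, hu_cont, funext fun q => ?_⟩
  obtain ⟨R, hR⟩ := V.cone_mem_nhds q
  obtain ⟨K, hK0, hK⟩ := V.lipschitz R
  have hq := mem_of_mem_nhds hR
  have h1 : Tendsto (fun n => a (n + 1) q) atTop (𝓝 (u q)) :=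
    ((hunif R).tendsto_at hq).comp (tendsto_add_atTop_nat 1)
  refine tendsto_nhds_unique (?_ : Tendsto (fun n => a (n + 1) q) atTop _) h1
  rw [Metric.tendsto_atTop]
  intro ε hε
  set δ := ε / (K * |q.1 - V.r| + 1) with hδ
  have hden : 0 < K * |q.1 - V.r| + 1 := by positivity
  have hδ0 : 0 < δ := by positivity
  obtain ⟨n₀, hn₀⟩ := eventually_atTop.1 ((Metric.tendstoUniformlyOn_iff.1 (hunif R)) δ hδ0)
  refine ⟨n₀, fun n hn => ?_⟩
  have h2 := norm_picard_sub_le hK hK0 (ha_cont n) hu_cont hδ0.le 0 (fun p hp => by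
    have := (hn₀ n hn p hp).le
    rw [dist_comm, dist_eq_norm] at this
    simpa using this) hq
  rw [ha_succ, dist_eq_norm]
  refine h2.trans_lt ?_
  have : δ * (K * |q.1 - V.r| + 1) = ε := by rw [hδ]; field_simp
  norm_num
  nlinarith

end Picard

end VolterraSystem

end Volterra

section Hadamard

/-! ### Hadamard quotients -/

/-- A function with a jointly continuous Hadamard quotient `D`, `f q - f p = D p q (q - p)`, is
continuously differentiable with derivative `D p p`. -/
theorem contDiff_one_of_hadamard {E F : Type*} [NormedAddCommGroup E] [NormedSpace ℝ E]
    [NormedAddCommGroup F] [NormedSpace ℝ F] {f : E → F} {D : E → E → E →L[ℝ] F}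
    (hD : Continuous fun q : E × E => D q.1 q.2) (h : ∀ p q, f q - f p = D p q (q - p)) :
    ContDiff ℝ 1 f := by
  refine contDiff_one_iff_hasFDerivAt.2 ⟨fun p => D p p,
    hD.comp (by fun_prop : Continuous fun p : E => (p, p)), fun p => ?_⟩
  rw [hasFDerivAt_iff_isLittleO]
  have e : (fun q => f q - f p - D p p (q - p)) = fun q => (D p q - D p p) (q - p) := by
    funext q; rw [h]; simp
  rw [e]
  have h1 : Tendsto (fun q => ‖D p q - D p p‖) (𝓝 p) (𝓝 0) := by
    have : Continuous fun q => ‖D p q - D p p‖ :=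
      ((hD.comp (by fun_prop : Continuous fun q : E => (p, q))).sub continuous_const).norm
    simpa using this.tendsto p
  refine Asymptotics.IsLittleO.of_bound fun c hc => ?_
  filter_upwards [h1.eventually (gt_mem_nhds hc)] with q hq
  exact (ContinuousLinearMap.le_opNorm _ _).trans
    (mul_le_mul_of_nonneg_right hq.le (norm_nonneg _))

/-- A primitive in time of a function with a Hadamard quotient in space is jointly `C¹`. -/
theorem contDiff_one_primitive {X : Type*} [NormedAddCommGroup X] [NormedSpace ℝ X]
    {k : ℝ → X → ℝ} {Γ : ℝ → X → X → X →L[ℝ] ℝ} (r : ℝ)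
    (hk : Continuous fun q : ℝ × X => k q.1 q.2)
    (hΓ : Continuous fun q : ℝ × X × X => Γ q.1 q.2.1 q.2.2)
    (h : ∀ s p q, k s q - k s p = Γ s p q (q - p)) :
    ContDiff ℝ 1 fun q : ℝ × X => ∫ s in r..q.1, k s q.2 := by
  have hm : Continuous fun w : (ℝ × X) × (ℝ × X) =>
      ∫ θ in (0 : ℝ)..1, k (w.1.1 + θ * (w.2.1 - w.1.1)) w.2.2 :=
    intervalIntegral.continuous_parametric_intervalIntegral_of_continuous
      (f := fun (w : (ℝ × X) × (ℝ × X)) θ => k (w.1.1 + θ * (w.2.1 - w.1.1)) w.2.2)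
      (hk.comp (by fun_prop : Continuous fun v : ((ℝ × X) × (ℝ × X)) × ℝ =>
        (v.1.1.1 + v.2 * (v.1.2.1 - v.1.1.1), v.1.2.2))) continuous_const
  have hn : Continuous fun w : (ℝ × X) × (ℝ × X) => ∫ s in r..w.1.1, Γ s w.1.2 w.2.2 :=
    intervalIntegral.continuous_parametric_intervalIntegral_of_continuous
      (f := fun (w : (ℝ × X) × (ℝ × X)) s => Γ s w.1.2 w.2.2)
      (hΓ.comp (by fun_prop : Continuous fun v : ((ℝ × X) × (ℝ × X)) × ℝ =>
        (v.2, v.1.1.2, v.1.2.2))) (by fun_prop)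
  have hki : ∀ x a b, IntervalIntegrable (fun s => k s x) volume a b := fun x a b =>
    (hk.comp (by fun_prop : Continuous fun s : ℝ => (s, x))).intervalIntegrable a b
  have hΓi : ∀ x y a b, IntervalIntegrable (fun s => Γ s x y) volume a b := fun x y a b =>
    (hΓ.comp (by fun_prop : Continuous fun s : ℝ => (s, x, y))).intervalIntegrable a b
  refine contDiff_one_of_hadamard (D := fun p q =>
    (∫ θ in (0 : ℝ)..1, k (p.1 + θ * (q.1 - p.1)) q.2) • ContinuousLinearMap.fst ℝ ℝ X
      + (∫ s in r..p.1, Γ s p.2 q.2).comp (ContinuousLinearMap.snd ℝ ℝ X)) ?_ ?_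
  · exact (hm.smul continuous_const).add (hn.clm_comp continuous_const)
  · intro p q
    have e1 : (∫ θ in (0 : ℝ)..1, k (p.1 + θ * (q.1 - p.1)) q.2) * (q.1 - p.1)
        = ∫ s in p.1..q.1, k s q.2 := by
      rw [mul_comm, ← smul_eq_mul]
      have := intervalIntegral.smul_integral_comp_add_mul (a := 0) (b := 1)
        (fun s => k s q.2) (q.1 - p.1) p.1
      simp only [mul_zero, add_zero, mul_one, add_sub_cancel] at this
      rw [← this]
      simp only [mul_comm]
    have e2 : (∫ s in r..p.1, Γ s p.2 q.2) (q.2 - p.2)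
        = (∫ s in r..p.1, k s q.2) - ∫ s in r..p.1, k s p.2 := by
      rw [ContinuousLinearMap.intervalIntegral_apply (hΓi _ _ _ _),
        ← intervalIntegral.integral_sub (hki _ _ _) (hki _ _ _)]
      simp only [h]
    have e3 := intervalIntegral.integral_add_adjacent_intervals (hki q.2 r p.1) (hki q.2 p.1 q.1)
    simp only [add_apply, smul_apply,
      ContinuousLinearMap.comp_apply, ContinuousLinearMap.coe_fst', ContinuousLinearMap.coe_snd',
      Prod.fst_sub, Prod.snd_sub, smul_eq_mul]
    rw [e1, e2, ← e3]
    ring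

variable {d : ℕ}

/-- The point with the first `n` coordinates of `Q` and the other coordinates of `P`. -/
def hybrid (n : ℕ) (P Q : Fin d → ℝ) : Fin d → ℝ := fun k => if (k : ℕ) < n then Q k else P k

theorem hybrid_succ (j : Fin d) (P Q : Fin d → ℝ) :
    hybrid (j + 1) P Q = hybrid j P Q + (Q j - P j) • Pi.single j (1 : ℝ) := by
  funext k
  by_cases hk : k = j
  · subst hk; simp [hybrid]
  · have : (k : ℕ) ≠ j := fun h => hk (Fin.ext h)
    have h2 : (k : ℕ) < j + 1 ↔ (k : ℕ) < j := by omega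
    simp [hybrid, hk, h2]

theorem continuous_hybrid (n : ℕ) :
    Continuous fun q : (Fin d → ℝ) × (Fin d → ℝ) => hybrid n q.1 q.2 := by
  refine continuous_pi fun k => ?_
  by_cases hk : (k : ℕ) < n
  · simp only [hybrid, hk, if_true]; fun_prop
  · simp only [hybrid, hk, if_false]; fun_prop

/-- Coefficients defined for all times, with `b` and its partial derivatives `b' j` continuous, the
derivatives bounded, and `σ` continuous and bounded by `S`. The normalization `1 ≤ S` makes the
cones `‖x‖ + S |t - r| ≤ R` bounded in time. -/
structure GlobalCoefficients (b : ℝ → (Fin d → ℝ) → Fin d → ℝ)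
    (b' : Fin d → ℝ → (Fin d → ℝ) → Fin d → ℝ) (σ : Fin d → ℝ → ℝ) (S : ℝ) : Prop where
  b_cont : Continuous fun q : ℝ × (Fin d → ℝ) => b q.1 q.2
  b'_cont : ∀ j, Continuous fun q : ℝ × (Fin d → ℝ) => b' j q.1 q.2
  b'_bdd : ∀ j, ∃ M : ℝ, ∀ t x, ‖b' j t x‖ ≤ M
  hasLineDerivAt : ∀ j t x, HasLineDerivAt ℝ (b t) (b' j t x) x (Pi.single j 1)
  σ_cont : ∀ i, Continuous (σ i)
  σ_bdd : ∀ i t, |σ i t| ≤ S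
  one_le : 1 ≤ S

variable {b : ℝ → (Fin d → ℝ) → Fin d → ℝ} {b' : Fin d → ℝ → (Fin d → ℝ) → Fin d → ℝ}
  {σ : Fin d → ℝ → ℝ} {S : ℝ}

/-- A continuous Hadamard quotient of `b(s,·)` in the `j`-th coordinate: the mean of the `j`-th
partial derivative over the `j`-th edge of the path from `P` to `Q` that changes one coordinate
after the other. -/
def quotient (b' : Fin d → ℝ → (Fin d → ℝ) → Fin d → ℝ) (j : Fin d) (s : ℝ)
    (P Q : Fin d → ℝ) : Fin d → ℝ :=
  ∫ θ in (0 : ℝ)..1, b' j s (hybrid j P Q + θ • ((Q j - P j) • Pi.single j (1 : ℝ)))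

namespace GlobalCoefficients

theorem continuous_quotient (hb : GlobalCoefficients b b' σ S) (j : Fin d) :
    Continuous fun q : ℝ × (Fin d → ℝ) × (Fin d → ℝ) => quotient b' j q.1 q.2.1 q.2.2 := by
  have h : Continuous fun v : (ℝ × (Fin d → ℝ) × (Fin d → ℝ)) × ℝ => (v.1.1, hybrid j v.1.2.1 v.1.2.2
      + v.2 • ((v.1.2.2 j - v.1.2.1 j) • (Pi.single j (1 : ℝ) : Fin d → ℝ))) := by
    refine Continuous.prodMk (by fun_prop) (((continuous_hybrid j).comp
      (by fun_prop : Continuous fun q : (ℝ × (Fin d → ℝ) × (Fin d → ℝ)) × ℝ => q.1.2)).add ?_)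
    fun_prop
  exact intervalIntegral.continuous_parametric_intervalIntegral_of_continuous
    (f := fun (q : ℝ × (Fin d → ℝ) × (Fin d → ℝ)) θ =>
      b' j q.1 (hybrid j q.2.1 q.2.2
        + θ • ((q.2.2 j - q.2.1 j) • (Pi.single j (1 : ℝ) : Fin d → ℝ))))
    ((hb.b'_cont j).comp h) continuous_const

theorem sub_eq_sum_quotient (hb : GlobalCoefficients b b' σ S) (s : ℝ) (P Q : Fin d → ℝ) :
    b s Q - b s P = ∑ j, (Q j - P j) • quotient b' j s P Q := by
  have h0 : hybrid 0 P Q = P := by funext k; simp [hybrid]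
  have h1 : hybrid d P Q = Q := by funext k; simp [hybrid]
  have step : ∀ j : Fin d, b s (hybrid (j + 1) P Q) - b s (hybrid j P Q)
      = (Q j - P j) • quotient b' j s P Q := by
    intro j
    set y : ℝ → Fin d → ℝ := fun θ =>
      hybrid j P Q + θ • ((Q j - P j) • Pi.single j (1 : ℝ)) with hy
    have hd : ∀ θ ∈ uIcc (0 : ℝ) 1,
        HasDerivAt (fun θ => b s (y θ)) ((Q j - P j) • b' j s (y θ)) θ := by
      intro θ _
      have h2 : HasDerivAt (fun τ : ℝ => b s (y θ + τ • Pi.single j (1 : ℝ)))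
          (b' j s (y θ)) 0 := hb.hasLineDerivAt j s (y θ)
      have h3 : HasDerivAt (fun θ' : ℝ => (θ' - θ) * (Q j - P j)) (Q j - P j) θ := by
        simpa using ((hasDerivAt_id θ).sub_const θ).mul_const (Q j - P j)
      have h4 : HasDerivAt (fun τ : ℝ => b s (y θ + τ • Pi.single j (1 : ℝ)))
          (b' j s (y θ)) ((θ - θ) * (Q j - P j)) := by simpa using h2
      have h5 := HasDerivAt.scomp θ h4 h3
      refine h5.congr_of_eventuallyEq (Eventually.of_forall fun θ' => ?_)
      simp only [Function.comp, hy, smul_smul]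
      congr 1
      rw [add_assoc, ← add_smul]
      congr 2
      ring
    have hc0 : Continuous fun θ => b' j s (y θ) :=
      (hb.b'_cont j).comp (by fun_prop : Continuous fun θ : ℝ => (s, y θ))
    have hc : Continuous fun θ => (Q j - P j) • b' j s (y θ) := hc0.const_smul (Q j - P j)
    have := intervalIntegral.integral_eq_sub_of_hasDerivAt hd (hc.intervalIntegrable 0 1)
    rw [intervalIntegral.integral_smul] at this
    rw [hybrid_succ]
    simpa [hy, quotient] using this.symm
  calc b s Q - b s P = b s (hybrid d P Q) - b s (hybrid 0 P Q) := by rw [h0, h1]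
    _ = ∑ n ∈ Finset.range d, (b s (hybrid (n + 1) P Q) - b s (hybrid n P Q)) :=
        (Finset.sum_range_sub (fun n => b s (hybrid n P Q)) d).symm
    _ = ∑ j : Fin d, (b s (hybrid (j + 1) P Q) - b s (hybrid j P Q)) :=
        Finset.sum_range fun n => b s (hybrid (n + 1) P Q) - b s (hybrid n P Q)
    _ = _ := Finset.sum_congr rfl fun j _ => step j

theorem exists_lipschitz (hb : GlobalCoefficients b b' σ S) :
    ∃ L, 0 ≤ L ∧ ∀ s P Q, ‖b s P - b s Q‖ ≤ L * ‖P - Q‖ := by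
  choose M hM using hb.b'_bdd
  have hM0 : ∀ j, 0 ≤ M j := fun j => (norm_nonneg _).trans (hM j 0 0)
  refine ⟨∑ j, M j, Finset.sum_nonneg fun j _ => hM0 j, fun s P Q => ?_⟩
  rw [hb.sub_eq_sum_quotient s Q P, Finset.sum_mul]
  refine (norm_sum_le _ _).trans (Finset.sum_le_sum fun j _ => ?_)
  rw [norm_smul, mul_comm]
  have h1 : ‖quotient b' j s Q P‖ ≤ M j := by
    have := intervalIntegral.norm_integral_le_of_norm_le_const (a := (0 : ℝ)) (b := 1) (C := M j)
      (f := fun θ : ℝ => b' j s (hybrid j Q P + θ • ((P j - Q j) • Pi.single j (1 : ℝ))))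
      fun θ _ => hM j s _
    simpa [quotient] using this
  have h2 : ‖P j - Q j‖ ≤ ‖P - Q‖ := norm_le_pi_norm (P - Q) j
  exact mul_le_mul h1 h2 (norm_nonneg _) (hM0 j)

end GlobalCoefficients

end Hadamard

section Weights

/-! ### Linear Volterra systems -/

/-- The system `u_i(t,z) = g_i(t,z) + ∫_r^t (∑_j c_{ij}(s,t,z) u_j(s,φ_i) + k_i(s,t,z)) ds`,
with `φ_i` evaluated at `(s,t,z)`. -/
def linearVolterra {ι Z F : Type*} [Fintype ι] [NormedAddCommGroup Z] [ProperSpace Z]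
    [NormedAddCommGroup F] [NormedSpace ℝ F] (r S : ℝ) (one_le : 1 ≤ S)
    (φ : ι → ℝ → ℝ → Z → Z) (hφ : ∀ i, Continuous fun q : ℝ × ℝ × Z => φ i q.1 q.2.1 q.2.2)
    (hφS : ∀ i s t z, ‖φ i s t z‖ ≤ ‖z‖ + S * |t - s|)
    (g : ι → ℝ → Z → F) (hg : ∀ i, Continuous fun q : ℝ × Z => g i q.1 q.2)
    (c : ι → ι → ℝ → ℝ → Z → ℝ)
    (hc : ∀ i j, Continuous fun q : ℝ × ℝ × Z => c i j q.1 q.2.1 q.2.2)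
    (k : ι → ℝ → ℝ → Z → F) (hk : ∀ i, Continuous fun q : ℝ × ℝ × Z => k i q.1 q.2.1 q.2.2) :
    VolterraSystem ι Z F where
  r := r
  S := S
  φ := φ
  g := g
  G i s t z p := ∑ j, c i j s t z • p j + k i s t z
  one_le := one_le
  continuous_φ := hφ
  norm_φ_le := hφS
  continuous_g := hg
  continuous_G i := by
    have h1 : Continuous fun q : ℝ × ℝ × Z × (ι → F) => (q.1, q.2.1, q.2.2.1) := by fun_prop
    refine Continuous.add (continuous_finsetSum _ fun j _ => ((hc i j).comp h1).smul ?_)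
      ((hk i).comp h1)
    fun_prop
  lipschitz R := by
    have hcpt : IsCompact (Metric.closedBall r R ×ˢ Metric.closedBall r R ×ˢ
        Metric.closedBall (0 : Z) R) :=
      (isCompact_closedBall _ _).prod ((isCompact_closedBall _ _).prod (isCompact_closedBall _ _))
    have hex : ∀ i j, ∃ C, ∀ q ∈ Metric.closedBall r R ×ˢ Metric.closedBall r R ×ˢ
        Metric.closedBall (0 : Z) R, ‖c i j q.1 q.2.1 q.2.2‖ ≤ C := fun i j =>
      hcpt.exists_bound_of_continuousOn (hc i j).continuousOn
    choose C hC using hex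
    refine ⟨∑ i, ∑ j, max (C i j) 0, Finset.sum_nonneg fun i _ => Finset.sum_nonneg fun j _ =>
      le_max_right _ _, fun i s t z p q hs ht hz => ?_⟩
    rw [add_sub_add_right_eq_sub, ← Finset.sum_sub_distrib]
    have h1 : ∑ j, max (C i j) 0 ≤ ∑ i, ∑ j, max (C i j) 0 :=
      Finset.single_le_sum (f := fun i => ∑ j, max (C i j) 0)
        (fun i _ => Finset.sum_nonneg fun j _ => le_max_right _ _) (Finset.mem_univ i)
    refine le_trans ?_ (mul_le_mul_of_nonneg_right h1 (norm_nonneg _))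
    rw [Finset.sum_mul]
    refine (norm_sum_le _ _).trans (Finset.sum_le_sum fun j _ => ?_)
    rw [← smul_sub, norm_smul]
    have h2 : ‖c i j s t z‖ ≤ max (C i j) 0 :=
      (hC i j (s, t, z) ⟨by simpa [Real.dist_eq] using hs, by simpa [Real.dist_eq] using ht,
        by simpa using hz⟩).trans (le_max_left _ _)
    exact mul_le_mul h2 (norm_le_pi_norm (p - q) j) (norm_nonneg _) (le_max_right _ _)

/-! ### Characteristics and the exponential factor -/

variable {d : ℕ} {b : ℝ → (Fin d → ℝ) → Fin d → ℝ} {b' : Fin d → ℝ → (Fin d → ℝ) → Fin d → ℝ}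
  {σ : Fin d → ℝ → ℝ} {S : ℝ}

/-- The displacement `∫_s^t σ_i` along the `i`-th characteristics, as a difference of primitives so
that `displacement_add` is an identity of the ring. -/
def displacement (σ : Fin d → ℝ → ℝ) (i : Fin d) (s t : ℝ) : ℝ :=
  (∫ r in (0 : ℝ)..t, σ i r) - ∫ r in (0 : ℝ)..s, σ i r

/-- The weight `exp((x a - a²/2)/h)`, `a = ∫_s^t σ_i`, which the term `σ_i (x_i/h) u_i` produces
along the `i`-th characteristic ending at time `t` at a point with `i`-th coordinate `x`. It is
`ℰ_i^π(s,t)` when `x` is the increment of `B_i` over a partition interval of length `h`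
containing `[s,t]`. -/
def weight (σ : Fin d → ℝ → ℝ) (h : ℝ) (i : Fin d) (s t x : ℝ) : ℝ :=
  Real.exp ((x * displacement σ i s t - displacement σ i s t ^ 2 / 2) / h)

theorem displacement_add (σ : Fin d → ℝ → ℝ) (i : Fin d) (s r t : ℝ) :
    displacement σ i s r + displacement σ i r t = displacement σ i s t := by
  simp only [displacement]; ring

@[simp] theorem displacement_self (σ : Fin d → ℝ → ℝ) (i : Fin d) (t : ℝ) :
    displacement σ i t t = 0 := by
  simp [displacement]

@[simp] theorem weight_self (σ : Fin d → ℝ → ℝ) (h : ℝ) (i : Fin d) (t x : ℝ) :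
    weight σ h i t t x = 1 := by
  simp [weight]

theorem weight_mul (σ : Fin d → ℝ → ℝ) (h : ℝ) (i : Fin d) (s r t x : ℝ) :
    weight σ h i r t x * weight σ h i s r (x - displacement σ i r t) = weight σ h i s t x := by
  rw [weight, weight, weight, ← Real.exp_add, ← displacement_add σ i s r t]
  congr 1
  ring

namespace GlobalCoefficients

theorem hasDerivAt_displacement (hb : GlobalCoefficients b b' σ S) (i : Fin d) (s t : ℝ) :
    HasDerivAt (displacement σ i s) (σ i t) t :=
  (intervalIntegral.integral_hasDerivAt_right ((hb.σ_cont i).intervalIntegrable _ _)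
    (hb.σ_cont i).stronglyMeasurable.stronglyMeasurableAtFilter
    (hb.σ_cont i).continuousAt).sub_const _

theorem continuous_displacement (hb : GlobalCoefficients b b' σ S) (i : Fin d) :
    Continuous fun q : ℝ × ℝ => displacement σ i q.1 q.2 := by
  have h : Continuous fun t => ∫ r in (0 : ℝ)..t, σ i r :=
    intervalIntegral.continuous_primitive (fun a b => (hb.σ_cont i).intervalIntegrable a b) 0
  exact (h.comp continuous_snd).sub (h.comp continuous_fst)

theorem contDiff_displacement (hb : GlobalCoefficients b b' σ S) (i : Fin d) (s : ℝ) :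
    ContDiff ℝ 1 (displacement σ i s) := by
  refine contDiff_one_iff_deriv.2
    ⟨fun t => (hb.hasDerivAt_displacement i s t).differentiableAt, ?_⟩
  rw [show deriv (displacement σ i s) = σ i from
    funext fun t => (hb.hasDerivAt_displacement i s t).deriv]
  exact hb.σ_cont i

theorem displacement_eq (hb : GlobalCoefficients b b' σ S) (i : Fin d) (s t : ℝ) :
    displacement σ i s t = ∫ r in s..t, σ i r :=
  intervalIntegral.integral_interval_sub_left ((hb.σ_cont i).intervalIntegrable _ _)
    ((hb.σ_cont i).intervalIntegrable _ _)

theorem abs_displacement_le (hb : GlobalCoefficients b b' σ S) (i : Fin d) (s t : ℝ) :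
    |displacement σ i s t| ≤ S * |t - s| := by
  rw [hb.displacement_eq]
  exact intervalIntegral.norm_integral_le_of_norm_le_const fun r _ =>
    (Real.norm_eq_abs _).trans_le (hb.σ_bdd i r)

theorem continuous_weight (hb : GlobalCoefficients b b' σ S) (h : ℝ) (i : Fin d) :
    Continuous fun q : ℝ × ℝ × ℝ => weight σ h i q.1 q.2.1 q.2.2 := by
  have h1 : Continuous fun q : ℝ × ℝ × ℝ => displacement σ i q.1 q.2.1 :=
    (hb.continuous_displacement i).comp (by fun_prop : Continuous fun q : ℝ × ℝ × ℝ => (q.1, q.2.1))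
  unfold weight
  fun_prop

theorem norm_transport_le (hb : GlobalCoefficients b b' σ S) (i : Fin d) (s t : ℝ)
    (x : Fin d → ℝ) : ‖x - Pi.single i (displacement σ i s t)‖ ≤ ‖x‖ + S * |t - s| := by
  refine (norm_sub_le _ _).trans (add_le_add_right ?_ _)
  rw [Pi.norm_single]
  exact hb.abs_displacement_le i s t

theorem continuous_transport (hb : GlobalCoefficients b b' σ S) (i : Fin d) :
    Continuous fun q : ℝ × ℝ × (Fin d → ℝ) =>
      q.2.2 - (Pi.single i (displacement σ i q.1 q.2.1) : Fin d → ℝ) := by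
  have h1 : Continuous fun q : ℝ × ℝ × (Fin d → ℝ) => displacement σ i q.1 q.2.1 :=
    (hb.continuous_displacement i).comp
      (by fun_prop : Continuous fun q : ℝ × ℝ × (Fin d → ℝ) => (q.1, q.2.1))
  exact (by fun_prop : Continuous fun q : ℝ × ℝ × (Fin d → ℝ) => q.2.2).sub
    ((continuous_single (A := fun _ : Fin d => ℝ) i).comp h1)

end GlobalCoefficients

/-- A continuous Hadamard quotient of the weight in its last variable. -/
def weightQuotient (σ : Fin d → ℝ → ℝ) (h : ℝ) (i : Fin d) (s t p q : ℝ) : ℝ :=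
  weight σ h i s t p * (displacement σ i s t / h) *
    dslope Real.exp 0 ((q - p) * (displacement σ i s t / h))

theorem weightQuotient_mul (σ : Fin d → ℝ → ℝ) (h : ℝ) (i : Fin d) (s t p q : ℝ) :
    weightQuotient σ h i s t p q * (q - p) = weight σ h i s t q - weight σ h i s t p := by
  have h1 := sub_smul_dslope Real.exp 0 ((q - p) * (displacement σ i s t / h))
  rw [sub_zero, smul_eq_mul, Real.exp_zero] at h1
  have h2 : weight σ h i s t q
      = weight σ h i s t p * Real.exp ((q - p) * (displacement σ i s t / h)) := by
    rw [weight, weight, ← Real.exp_add]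
    congr 1
    ring
  rw [h2, weightQuotient]
  linear_combination weight σ h i s t p * h1

theorem GlobalCoefficients.continuous_weightQuotient (hb : GlobalCoefficients b b' σ S) (h : ℝ)
    (i : Fin d) :
    Continuous fun q : ℝ × ℝ × ℝ × ℝ => weightQuotient σ h i q.1 q.2.1 q.2.2.1 q.2.2.2 := by
  have h0 : Continuous (dslope Real.exp 0) := by
    refine continuous_iff_continuousAt.2 fun y => ?_
    rcases eq_or_ne y 0 with rfl | hy
    · exact continuousAt_dslope_same.2 Real.differentiableAt_exp
    · exact (continuousAt_dslope_of_ne hy).2 Real.continuous_exp.continuousAt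
  have h1 : Continuous fun q : ℝ × ℝ × ℝ × ℝ => displacement σ i q.1 q.2.1 :=
    (hb.continuous_displacement i).comp
      (by fun_prop : Continuous fun q : ℝ × ℝ × ℝ × ℝ => (q.1, q.2.1))
  have h2 : Continuous fun q : ℝ × ℝ × ℝ × ℝ => weight σ h i q.1 q.2.1 q.2.2.1 :=
    (hb.continuous_weight h i).comp
      (by fun_prop : Continuous fun q : ℝ × ℝ × ℝ × ℝ => (q.1, q.2.1, q.2.2.1))
  unfold weightQuotient
  fun_prop

/-! ### The semilinear hyperbolic system -/

/-- A function `f` of time and space satisfies the mild form of the hyperbolic system with initial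
value `α` at time `r`. -/
def IsMildPDESolution (b : ℝ → (Fin d → ℝ) → Fin d → ℝ) (σ : Fin d → ℝ → ℝ) (h r : ℝ) (α : Fin d → ℝ)
    (f : ℝ → (Fin d → ℝ) → Fin d → ℝ) : Prop :=
  ∀ t x i, f t x i = α i * weight σ h i r t (x i) +
    ∫ s in r..t, b s (f s (x - Pi.single i (displacement σ i s t))) i * weight σ h i s t (x i)

namespace GlobalCoefficients

/-- The mild form of the hyperbolic system, with the initial value `α` as a second space variable,
so that solutions are jointly continuous in `(t,x,α)`. -/
def mildSystem (hb : GlobalCoefficients b b' σ S) (h r : ℝ) :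
    VolterraSystem (Fin d) ((Fin d → ℝ) × (Fin d → ℝ)) ℝ where
  r := r
  S := S
  φ i s t z := (z.1 - Pi.single i (displacement σ i s t), z.2)
  g i t z := z.2 i * weight σ h i r t (z.1 i)
  G i s t z p := b s p i * weight σ h i s t (z.1 i)
  one_le := hb.one_le
  continuous_φ i := ((hb.continuous_transport i).comp
      (by fun_prop : Continuous fun q : ℝ × ℝ × (Fin d → ℝ) × (Fin d → ℝ) =>
        (q.1, q.2.1, q.2.2.1))).prodMk (by fun_prop)
  norm_φ_le i s t z := by
    have h0 : 0 ≤ S * |t - s| := mul_nonneg (zero_le_one.trans hb.one_le) (abs_nonneg _)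
    refine max_le ((hb.norm_transport_le i s t z.1).trans ?_) ?_
    · exact add_le_add_left (norm_fst_le z) _
    · exact (norm_snd_le z).trans (le_add_of_nonneg_right h0)
  continuous_g i := by
    have h1 : Continuous fun q : ℝ × (Fin d → ℝ) × (Fin d → ℝ) => weight σ h i r q.1 (q.2.1 i) :=
      (hb.continuous_weight h i).comp
        (by fun_prop : Continuous fun q : ℝ × (Fin d → ℝ) × (Fin d → ℝ) => (r, q.1, q.2.1 i))
    fun_prop
  continuous_G i := by
    have h1 : Continuous fun q : ℝ × ℝ × ((Fin d → ℝ) × (Fin d → ℝ)) × (Fin d → ℝ) =>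
        weight σ h i q.1 q.2.1 (q.2.2.1.1 i) :=
      (hb.continuous_weight h i).comp (by fun_prop :
        Continuous fun q : ℝ × ℝ × ((Fin d → ℝ) × (Fin d → ℝ)) × (Fin d → ℝ) =>
          (q.1, q.2.1, q.2.2.1.1 i))
    have h2 : Continuous fun q : ℝ × ℝ × ((Fin d → ℝ) × (Fin d → ℝ)) × (Fin d → ℝ) =>
        b q.1 q.2.2.2 :=
      hb.b_cont.comp (by fun_prop :
        Continuous fun q : ℝ × ℝ × ((Fin d → ℝ) × (Fin d → ℝ)) × (Fin d → ℝ) => (q.1, q.2.2.2))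
    exact ((continuous_apply i).comp h2).mul h1
  lipschitz R := by
    obtain ⟨L, hL0, hL⟩ := hb.exists_lipschitz
    have hcpt : IsCompact (Metric.closedBall r R ×ˢ Metric.closedBall r R ×ˢ
        Metric.closedBall (0 : ℝ) R) :=
      (isCompact_closedBall _ _).prod ((isCompact_closedBall _ _).prod (isCompact_closedBall _ _))
    have hex : ∀ i, ∃ C, ∀ q ∈ Metric.closedBall r R ×ˢ Metric.closedBall r R ×ˢ
        Metric.closedBall (0 : ℝ) R, ‖weight σ h i q.1 q.2.1 q.2.2‖ ≤ C := fun i =>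
      hcpt.exists_bound_of_continuousOn (hb.continuous_weight h i).continuousOn
    choose C hC using hex
    have h0 : 0 ≤ ∑ i, max (C i) 0 := Finset.sum_nonneg fun i _ => le_max_right _ _
    refine ⟨L * ∑ i, max (C i) 0, mul_nonneg hL0 h0, fun i s t z p q hs ht hz => ?_⟩
    rw [← sub_mul, norm_mul]
    have h1 : ‖b s p i - b s q i‖ ≤ L * ‖p - q‖ :=
      (norm_le_pi_norm (b s p - b s q) i).trans (hL s p q)
    have h2 : ‖weight σ h i s t (z.1 i)‖ ≤ ∑ i, max (C i) 0 := by
      refine (hC i (s, t, z.1 i) ⟨by simpa [Real.dist_eq] using hs,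
        by simpa [Real.dist_eq] using ht, ?_⟩).trans ((le_max_left _ 0).trans ?_)
      · simpa using (norm_le_pi_norm z.1 i).trans ((norm_fst_le z).trans hz)
      · exact Finset.single_le_sum (f := fun i => max (C i) 0) (fun i _ => le_max_right _ _)
          (Finset.mem_univ i)
    calc _ ≤ (L * ‖p - q‖) * ∑ i, max (C i) 0 :=
          mul_le_mul h1 h2 (norm_nonneg _) (by positivity)
      _ = _ := by ring

/-- Existence of mild solutions, jointly continuous in the initial value, time and space. -/
theorem exists_isMildPDESolution (hb : GlobalCoefficients b b' σ S) (h r : ℝ) :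
    ∃ u : (Fin d → ℝ) → ℝ → (Fin d → ℝ) → Fin d → ℝ,
      (Continuous fun q : (Fin d → ℝ) × ℝ × (Fin d → ℝ) => u q.1 q.2.1 q.2.2) ∧
      ∀ α, IsMildPDESolution b σ h r α (u α) := by
  obtain ⟨u, hu, hu'⟩ := (hb.mildSystem h r).exists_picard_eq
  refine ⟨fun α t x => u (t, x, α), hu.comp (by fun_prop : Continuous
    fun q : (Fin d → ℝ) × ℝ × (Fin d → ℝ) => (q.2.1, q.2.2, q.1)), fun α t x i => ?_⟩
  exact (congrFun (congrFun hu' (t, x, α)) i).symm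

end GlobalCoefficients

end Weights

section Regularity

variable {d : ℕ} {b : ℝ → (Fin d → ℝ) → Fin d → ℝ} {b' : Fin d → ℝ → (Fin d → ℝ) → Fin d → ℝ}
  {σ : Fin d → ℝ → ℝ} {S : ℝ}

/-! ### Regularity of mild solutions -/

/-- The matrix coefficient of the linear system for the Hadamard quotient of `f`. -/
def quotientCoeff (b' : Fin d → ℝ → (Fin d → ℝ) → Fin d → ℝ) (σ : Fin d → ℝ → ℝ) (h : ℝ)
    (f : ℝ → (Fin d → ℝ) → Fin d → ℝ) (i j : Fin d) (s t : ℝ) (z : (Fin d → ℝ) × (Fin d → ℝ)) :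
    ℝ :=
  weight σ h i s t (z.1 i) *
    quotient b' j s (f s (z.1 - Pi.single i (displacement σ i s t)))
      (f s (z.2 - Pi.single i (displacement σ i s t))) i

/-- The inhomogeneity of the linear system for the Hadamard quotient of `f`. -/
def quotientSource (b : ℝ → (Fin d → ℝ) → Fin d → ℝ) (σ : Fin d → ℝ → ℝ) (h : ℝ)
    (f : ℝ → (Fin d → ℝ) → Fin d → ℝ) (i : Fin d) (s t : ℝ) (z : (Fin d → ℝ) × (Fin d → ℝ)) : ℝ :=
  b s (f s (z.2 - Pi.single i (displacement σ i s t))) i *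
    weightQuotient σ h i s t (z.1 i) (z.2 i)

/-- Both points of a pair move along the same characteristic. -/
def pairTransport (σ : Fin d → ℝ → ℝ) (i : Fin d) (s t : ℝ) (z : (Fin d → ℝ) × (Fin d → ℝ)) :
    (Fin d → ℝ) × (Fin d → ℝ) :=
  (z.1 - Pi.single i (displacement σ i s t), z.2 - Pi.single i (displacement σ i s t))

namespace GlobalCoefficients

variable {f : ℝ → (Fin d → ℝ) → Fin d → ℝ}

theorem continuous_transport_comp (hb : GlobalCoefficients b b' σ S)
    (hf : Continuous fun q : ℝ × (Fin d → ℝ) => f q.1 q.2) (i : Fin d) :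
    Continuous fun q : ℝ × ℝ × (Fin d → ℝ) =>
      f q.1 (q.2.2 - Pi.single i (displacement σ i q.1 q.2.1)) :=
  hf.comp (continuous_fst.prodMk (hb.continuous_transport i))

theorem continuous_quotientCoeff (hb : GlobalCoefficients b b' σ S) (h : ℝ)
    (hf : Continuous fun q : ℝ × (Fin d → ℝ) => f q.1 q.2) (i j : Fin d) :
    Continuous fun q : ℝ × ℝ × (Fin d → ℝ) × (Fin d → ℝ) =>
      quotientCoeff b' σ h f i j q.1 q.2.1 q.2.2 := by
  have h1 := (hb.continuous_transport_comp hf i).comp (by fun_prop :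
    Continuous fun q : ℝ × ℝ × (Fin d → ℝ) × (Fin d → ℝ) => (q.1, q.2.1, q.2.2.1))
  have h2 := (hb.continuous_transport_comp hf i).comp (by fun_prop :
    Continuous fun q : ℝ × ℝ × (Fin d → ℝ) × (Fin d → ℝ) => (q.1, q.2.1, q.2.2.2))
  have h3 := (hb.continuous_weight h i).comp (by fun_prop :
    Continuous fun q : ℝ × ℝ × (Fin d → ℝ) × (Fin d → ℝ) => (q.1, q.2.1, q.2.2.1 i))
  have h4 := (hb.continuous_quotient j).comp
    ((continuous_fst (X := ℝ) (Y := ℝ × (Fin d → ℝ) × (Fin d → ℝ))).prodMk (h1.prodMk h2))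
  exact h3.mul ((continuous_apply i).comp h4)

theorem continuous_quotientSource (hb : GlobalCoefficients b b' σ S) (h : ℝ)
    (hf : Continuous fun q : ℝ × (Fin d → ℝ) => f q.1 q.2) (i : Fin d) :
    Continuous fun q : ℝ × ℝ × (Fin d → ℝ) × (Fin d → ℝ) =>
      quotientSource b σ h f i q.1 q.2.1 q.2.2 := by
  have h2 := (hb.continuous_transport_comp hf i).comp (by fun_prop :
    Continuous fun q : ℝ × ℝ × (Fin d → ℝ) × (Fin d → ℝ) => (q.1, q.2.1, q.2.2.2))
  have h3 := (hb.continuous_weightQuotient h i).comp (by fun_prop :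
    Continuous fun q : ℝ × ℝ × (Fin d → ℝ) × (Fin d → ℝ) => (q.1, q.2.1, q.2.2.1 i, q.2.2.2 i))
  have h4 := hb.b_cont.comp
    ((continuous_fst (X := ℝ) (Y := ℝ × (Fin d → ℝ) × (Fin d → ℝ))).prodMk h2)
  exact ((continuous_apply i).comp h4).mul h3

theorem continuous_pairTransport (hb : GlobalCoefficients b b' σ S) (i : Fin d) :
    Continuous fun q : ℝ × ℝ × (Fin d → ℝ) × (Fin d → ℝ) =>
      pairTransport σ i q.1 q.2.1 q.2.2 := by
  have h1 := (hb.continuous_transport i).comp (by fun_prop :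
    Continuous fun q : ℝ × ℝ × (Fin d → ℝ) × (Fin d → ℝ) => (q.1, q.2.1, q.2.2.1))
  have h2 := (hb.continuous_transport i).comp (by fun_prop :
    Continuous fun q : ℝ × ℝ × (Fin d → ℝ) × (Fin d → ℝ) => (q.1, q.2.1, q.2.2.2))
  exact h1.prodMk h2

theorem norm_pairTransport_le (hb : GlobalCoefficients b b' σ S) (i : Fin d) (s t : ℝ)
    (z : (Fin d → ℝ) × (Fin d → ℝ)) :
    ‖pairTransport σ i s t z‖ ≤ ‖z‖ + S * |t - s| :=
  norm_prod_le_iff.2 ⟨(hb.norm_transport_le i s t z.1).trans (by gcongr; exact norm_fst_le z),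
    (hb.norm_transport_le i s t z.2).trans (by gcongr; exact norm_snd_le z)⟩

theorem continuous_quotientInitial (hb : GlobalCoefficients b b' σ S) (h r : ℝ) (α : Fin d → ℝ)
    (i : Fin d) :
    Continuous fun q : ℝ × (Fin d → ℝ) × (Fin d → ℝ) =>
      α i * weightQuotient σ h i r q.1 (q.2.1 i) (q.2.2 i) := by
  have h1 := (hb.continuous_weightQuotient h i).comp (by fun_prop :
    Continuous fun q : ℝ × (Fin d → ℝ) × (Fin d → ℝ) => (r, q.1, q.2.1 i, q.2.2 i))
  exact continuous_const.mul h1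

/-- The linear system on pairs `z = (p,q)` of points that the Hadamard quotient of `f` solves for
`ℓ i` the `i`-th coordinate functional, and `f q - f p` for `ℓ i` the number `q i - p i`. -/
def quotientSystem (hb : GlobalCoefficients b b' σ S) (h r : ℝ)
    (hf : Continuous fun q : ℝ × (Fin d → ℝ) => f q.1 q.2) (α : Fin d → ℝ)
    {F : Type*} [NormedAddCommGroup F] [NormedSpace ℝ F]
    (ℓ : Fin d → (Fin d → ℝ) × (Fin d → ℝ) → F) (hℓ : ∀ i, Continuous (ℓ i)) :
    VolterraSystem (Fin d) ((Fin d → ℝ) × (Fin d → ℝ)) F :=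
  linearVolterra (ι := Fin d) (Z := (Fin d → ℝ) × (Fin d → ℝ)) (F := F) (r := r) (S := S)
    (one_le := hb.one_le)
    (φ := pairTransport σ)
    (hφ := hb.continuous_pairTransport) (hφS := hb.norm_pairTransport_le)
    (g := fun i t z => (α i * weightQuotient σ h i r t (z.1 i) (z.2 i)) • ℓ i z)
    (hg := fun i => by
      have h1 := hb.continuous_quotientInitial h r α i
      have h2 := hℓ i
      fun_prop)
    (c := quotientCoeff b' σ h f) (hc := hb.continuous_quotientCoeff h hf)
    (k := fun i s t z => quotientSource b σ h f i s t z • ℓ i z)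
    (hk := fun i => by
      have h1 := hb.continuous_quotientSource h hf i
      have h2 := hℓ i
      fun_prop)

theorem quotientSystem_picard (hb : GlobalCoefficients b b' σ S) (h r : ℝ)
    (hf : Continuous fun q : ℝ × (Fin d → ℝ) => f q.1 q.2) (α : Fin d → ℝ)
    {F : Type*} [NormedAddCommGroup F] [NormedSpace ℝ F]
    (ℓ : Fin d → (Fin d → ℝ) × (Fin d → ℝ) → F) (hℓ : ∀ i, Continuous (ℓ i))
    (u : ℝ × ((Fin d → ℝ) × (Fin d → ℝ)) → Fin d → F) (t : ℝ)
    (z : (Fin d → ℝ) × (Fin d → ℝ)) (i : Fin d) :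
    (hb.quotientSystem h r hf α ℓ hℓ).picard u (t, z) i =
      (α i * weightQuotient σ h i r t (z.1 i) (z.2 i)) • ℓ i z + ∫ s in r..t,
        (∑ j, quotientCoeff b' σ h f i j s t z • u (s, pairTransport σ i s t z) j
          + quotientSource b σ h f i s t z • ℓ i z) := rfl

/-- The integrand of the mild equation at `z.2` minus the one at `z.1`. -/
theorem integrand_sub (hb : GlobalCoefficients b b' σ S) (h : ℝ) (i : Fin d) (s t : ℝ)
    (z : (Fin d → ℝ) × (Fin d → ℝ)) :
    b s (f s (z.2 - Pi.single i (displacement σ i s t))) i * weight σ h i s t (z.2 i)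
      - b s (f s (z.1 - Pi.single i (displacement σ i s t))) i * weight σ h i s t (z.1 i)
    = ∑ j, quotientCoeff b' σ h f i j s t z *
        (f s (z.2 - Pi.single i (displacement σ i s t)) j
          - f s (z.1 - Pi.single i (displacement σ i s t)) j)
      + quotientSource b σ h f i s t z * (z.2 i - z.1 i) := by
  have h1 := congrFun (hb.sub_eq_sum_quotient s
    (f s (z.1 - Pi.single i (displacement σ i s t)))
    (f s (z.2 - Pi.single i (displacement σ i s t)))) i
  rw [Finset.sum_apply, Pi.sub_apply] at h1
  have h2 := weightQuotient_mul σ h i s t (z.1 i) (z.2 i)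
  rw [quotientSource, mul_assoc, h2]
  have h3 : ∑ j, quotientCoeff b' σ h f i j s t z *
        (f s (z.2 - Pi.single i (displacement σ i s t)) j
          - f s (z.1 - Pi.single i (displacement σ i s t)) j)
      = weight σ h i s t (z.1 i) * (b s (f s (z.2 - Pi.single i (displacement σ i s t))) i
        - b s (f s (z.1 - Pi.single i (displacement σ i s t))) i) := by
    rw [h1, Finset.mul_sum]
    refine Finset.sum_congr rfl fun j _ => ?_
    simp only [quotientCoeff, Pi.smul_apply, smul_eq_mul]
    ring
  rw [h3]
  ring

theorem continuous_mildIntegrand (hb : GlobalCoefficients b b' σ S) (h : ℝ)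
    (hf : Continuous fun q : ℝ × (Fin d → ℝ) => f q.1 q.2) (i : Fin d) :
    Continuous fun q : ℝ × ℝ × (Fin d → ℝ) =>
      b q.1 (f q.1 (q.2.2 - Pi.single i (displacement σ i q.1 q.2.1))) i *
        weight σ h i q.1 q.2.1 (q.2.2 i) := by
  have h1 := hb.b_cont.comp ((continuous_fst (X := ℝ) (Y := ℝ × (Fin d → ℝ))).prodMk
    (hb.continuous_transport_comp hf i))
  exact ((continuous_apply i).comp h1).mul ((hb.continuous_weight h i).comp
    (by fun_prop : Continuous fun q : ℝ × ℝ × (Fin d → ℝ) => (q.1, q.2.1, q.2.2 i)))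

/-- A mild solution has a continuous Hadamard quotient in space. The linear system that such a
quotient must satisfy has a continuous solution `D` defined also on the diagonal, and both
`D (q - p)` and `f q - f p` solve the scalar version of that system, so they agree. -/
theorem exists_hadamard (hb : GlobalCoefficients b b' σ S) {h r : ℝ} {α : Fin d → ℝ}
    (hf : Continuous fun q : ℝ × (Fin d → ℝ) => f q.1 q.2)
    (hmild : IsMildPDESolution b σ h r α f) :
    ∃ D : ℝ × ((Fin d → ℝ) × (Fin d → ℝ)) → Fin d → ((Fin d → ℝ) →L[ℝ] ℝ), Continuous D ∧
      ∀ t p q i, f t q i - f t p i = D (t, (p, q)) i (q - p) := by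
  obtain ⟨D, hD, hD'⟩ := (hb.quotientSystem h r hf α
    (fun i _ => ContinuousLinearMap.proj (R := ℝ) (φ := fun _ : Fin d => ℝ) i)
    (fun i => continuous_const)).exists_picard_eq
  refine ⟨D, hD, ?_⟩
  set V := hb.quotientSystem h r hf α (fun i z => z.2 i - z.1 i) (fun i => by fun_prop) with hV
  have hu : Continuous fun (z : ℝ × ((Fin d → ℝ) × (Fin d → ℝ))) (i : Fin d) =>
      f z.1 z.2.2 i - f z.1 z.2.1 i := by
    have h1 := hf.comp (by fun_prop :
      Continuous fun z : ℝ × ((Fin d → ℝ) × (Fin d → ℝ)) => (z.1, z.2.2))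
    have h2 := hf.comp (by fun_prop :
      Continuous fun z : ℝ × ((Fin d → ℝ) × (Fin d → ℝ)) => (z.1, z.2.1))
    exact h1.sub h2
  have hv : Continuous fun (z : ℝ × ((Fin d → ℝ) × (Fin d → ℝ))) (i : Fin d) =>
      D z i (z.2.2 - z.2.1) :=
    continuous_pi fun i => ((continuous_apply i).comp hD).clm_apply (by fun_prop)
  have key := V.eq_of_picard_eq hu hv ?_ ?_
  · intro t p q i
    exact congrFun (congrFun key (t, (p, q))) i
  · funext ⟨t, p, q⟩ i
    have hi : ∀ x : Fin d → ℝ, IntervalIntegrable (fun s =>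
        b s (f s (x - Pi.single i (displacement σ i s t))) i * weight σ h i s t (x i))
        volume r t := fun x => ((hb.continuous_mildIntegrand h hf i).comp
          (by fun_prop : Continuous fun s : ℝ => (s, t, x))).intervalIntegrable _ _
    have e := hb.integrand_sub (f := f) h i
    rw [hV, quotientSystem_picard]
    simp only
    rw [hmild t q i, hmild t p i, add_sub_add_comm, ← intervalIntegral.integral_sub (hi q) (hi p),
      ← mul_sub, ← weightQuotient_mul, smul_eq_mul, mul_assoc]
    congr 1
    refine intervalIntegral.integral_congr fun s _ => ?_
    exact (e s t (p, q)).symm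
  · funext ⟨t, p, q⟩ i
    have h1 := congrFun (congrFun hD' (t, (p, q))) i
    have hint : IntervalIntegrable (fun s =>
        ∑ j, quotientCoeff b' σ h f i j s t (p, q) • D (s, pairTransport σ i s t (p, q)) j
          + quotientSource b σ h f i s t (p, q) •
            ContinuousLinearMap.proj (R := ℝ) (φ := fun _ : Fin d => ℝ) i) volume r t :=
      VolterraSystem.intervalIntegrable_integrand (V := hb.quotientSystem h r hf α
        (fun i _ => ContinuousLinearMap.proj (R := ℝ) (φ := fun _ : Fin d => ℝ) i)
        (fun i => continuous_const)) hD i (t, (p, q)) r t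
    rw [quotientSystem_picard] at h1
    rw [hV, quotientSystem_picard, ← h1, add_apply,
      ContinuousLinearMap.intervalIntegral_apply hint]
    congr 1
    refine intervalIntegral.integral_congr fun s _ => ?_
    simp [pairTransport, sub_sub_sub_cancel_right]

/-- The mild solution divided by the weight, along the `i`-th characteristic starting from `y` at
time `r`, is the primitive of a function that is `C¹` in space. -/
theorem contDiff_characteristic (hb : GlobalCoefficients b b' σ S) {h r : ℝ} {α : Fin d → ℝ}
    (hf : Continuous fun q : ℝ × (Fin d → ℝ) => f q.1 q.2)
    (hmild : IsMildPDESolution b σ h r α f) (i : Fin d) :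
    ContDiff ℝ 1 fun q : ℝ × (Fin d → ℝ) => α i + ∫ s in r..q.1,
      b s (f s (q.2 - Pi.single i (displacement σ i s r))) i * weight σ h i s r (q.2 i) := by
  obtain ⟨D, hD, hD'⟩ := hb.exists_hadamard hf hmild
  refine contDiff_const.add (contDiff_one_primitive
    (k := fun s x => b s (f s (x - Pi.single i (displacement σ i s r))) i * weight σ h i s r (x i))
    (Γ := fun s p q => ∑ j, quotientCoeff b' σ h f i j s r (p, q) •
          D (s, (p - Pi.single i (displacement σ i s r), q - Pi.single i (displacement σ i s r))) j
        + quotientSource b σ h f i s r (p, q) •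
          ContinuousLinearMap.proj (R := ℝ) (φ := fun _ : Fin d => ℝ) i) r ?_ ?_ ?_)
  · exact (hb.continuous_mildIntegrand h hf i).comp
      (by fun_prop : Continuous fun q : ℝ × (Fin d → ℝ) => (q.1, r, q.2))
  · have h1 := (hb.continuous_transport i).comp (by fun_prop :
      Continuous fun q : ℝ × (Fin d → ℝ) × (Fin d → ℝ) => (q.1, r, q.2.1))
    have h2 := (hb.continuous_transport i).comp (by fun_prop :
      Continuous fun q : ℝ × (Fin d → ℝ) × (Fin d → ℝ) => (q.1, r, q.2.2))
    have h3 := hD.comp ((continuous_fst (X := ℝ) (Y := (Fin d → ℝ) × (Fin d → ℝ))).prodMk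
      (h1.prodMk h2))
    have h4 : Continuous fun q : ℝ × (Fin d → ℝ) × (Fin d → ℝ) => (q.1, r, q.2) := by fun_prop
    exact (continuous_finsetSum _ fun j _ => ((hb.continuous_quotientCoeff h hf i j).comp h4).smul
      ((continuous_apply j).comp h3)).add
      (((hb.continuous_quotientSource h hf i).comp h4).smul continuous_const)
  · intro s p q
    have e := hb.integrand_sub (f := f) h i s r (p, q)
    simp only [hD', sub_sub_sub_cancel_right] at e
    rw [e]
    simp

/-- Factorization of a mild solution along the `i`-th characteristics. -/
theorem mild_eq_weight_mul {h r : ℝ} {α : Fin d → ℝ}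
    (hmild : IsMildPDESolution b σ h r α f) (t : ℝ) (x : Fin d → ℝ) (i : Fin d) :
    f t x i = weight σ h i r t (x i) * (α i + ∫ s in r..t,
      b s (f s ((x - Pi.single i (displacement σ i r t))
        - Pi.single i (displacement σ i s r))) i *
          weight σ h i s r ((x - (Pi.single i (displacement σ i r t) : Fin d → ℝ)) i)) := by
  rw [hmild t x i, mul_add, mul_comm (α i), ← intervalIntegral.integral_const_mul]
  congr 1
  refine intervalIntegral.integral_congr fun s _ => ?_
  rw [sub_sub, ← Pi.single_add, add_comm (displacement σ i r t), displacement_add,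
    Pi.sub_apply, Pi.single_eq_same, ← weight_mul σ h i s r t (x i)]
  ring

theorem contDiff_mild (hb : GlobalCoefficients b b' σ S) {h r : ℝ} {α : Fin d → ℝ}
    (hf : Continuous fun q : ℝ × (Fin d → ℝ) => f q.1 q.2)
    (hmild : IsMildPDESolution b σ h r α f) :
    ContDiff ℝ 1 fun q : ℝ × (Fin d → ℝ) => f q.1 q.2 := by
  refine contDiff_pi.2 fun i => ?_
  have e : (fun q : ℝ × (Fin d → ℝ) => f q.1 q.2 i) = fun q => weight σ h i r q.1 (q.2 i) *
      (fun q : ℝ × (Fin d → ℝ) => α i + ∫ s in r..q.1,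
        b s (f s (q.2 - Pi.single i (displacement σ i s r))) i * weight σ h i s r (q.2 i))
        (q.1, q.2 - Pi.single i (displacement σ i r q.1)) :=
    funext fun q => mild_eq_weight_mul hmild q.1 q.2 i
  rw [e]
  have h1 : ContDiff ℝ 1 fun q : ℝ × (Fin d → ℝ) => displacement σ i r q.1 :=
    (hb.contDiff_displacement i r).comp contDiff_fst
  have h2 : ContDiff ℝ 1 fun q : ℝ × (Fin d → ℝ) =>
      (Pi.single i (displacement σ i r q.1) : Fin d → ℝ) :=
    (ContinuousLinearMap.single ℝ (fun _ : Fin d => ℝ) i).contDiff.comp h1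
  have h3 : ContDiff ℝ 1 fun q : ℝ × (Fin d → ℝ) => q.2 i := by fun_prop
  refine ContDiff.mul ?_ ((hb.contDiff_characteristic hf hmild i).comp
    (contDiff_fst.prodMk (contDiff_snd.sub h2)))
  unfold weight
  exact (((h3.mul h1).sub ((h1.pow 2).div_const 2)).div_const h).exp

theorem mild_pde (hb : GlobalCoefficients b b' σ S) {h r : ℝ} {α : Fin d → ℝ}
    (hf : Continuous fun q : ℝ × (Fin d → ℝ) => f q.1 q.2)
    (hmild : IsMildPDESolution b σ h r α f) (t : ℝ) (x : Fin d → ℝ) (i : Fin d) :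
    HasDerivAt (fun q => f q x i)
      (-σ i t * lineDeriv ℝ (fun y => f t y i) x (Pi.single i 1)
        + σ i t * (x i / h) * f t x i + b t (f t x) i) t := by
  set e : Fin d → ℝ := Pi.single i (1 : ℝ) with he
  have hdiff : DifferentiableAt ℝ (fun q : ℝ × (Fin d → ℝ) => f q.1 q.2 i) (t, x) :=
    (contDiff_pi.1 (hb.contDiff_mild hf hmild) i).differentiable one_ne_zero _
  set L := fderiv ℝ (fun q : ℝ × (Fin d → ℝ) => f q.1 q.2 i) (t, x) with hL
  have hL' : HasFDerivAt (fun q : ℝ × (Fin d → ℝ) => f q.1 q.2 i) L (t, x) := hdiff.hasFDerivAt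
  have ht : HasDerivAt (fun q => f q x i) (L (1, 0)) t :=
    HasFDerivAt.comp_hasDerivAt (f := fun q : ℝ => (q, x)) t hL'
      ((hasDerivAt_id' t).prodMk (hasDerivAt_const t x))
  have hx : lineDeriv ℝ (fun y => f t y i) x e = L (0, e) := by
    have h1 : HasFDerivAt (fun y => f t y i) (L.comp (ContinuousLinearMap.inr ℝ ℝ (Fin d → ℝ))) x :=
      HasFDerivAt.comp x hL' (hasFDerivAt_prodMk_right t x)
    rw [h1.hasLineDerivAt e |>.lineDeriv]
    simp
  -- the derivative along the characteristic through `(t, x)`, first by the chain rule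
  have hdisp := hb.hasDerivAt_displacement i t t
  have hchar : HasDerivAt (fun q => f q (x + displacement σ i t q • e) i)
      (L (1, σ i t • e)) t := by
    have h1 : HasDerivAt (fun q => (q, x + displacement σ i t q • e)) (1, σ i t • e) t :=
      (hasDerivAt_id t).prodMk ((hdisp.smul_const e).const_add x)
    have h2 : HasFDerivAt (fun q : ℝ × (Fin d → ℝ) => f q.1 q.2 i) L
        (t, x + displacement σ i t t • e) := by simpa using hL'
    exact h2.comp_hasDerivAt t h1
  -- and then by the factorization, in which only the weight and the upper limit move
  set y : Fin d → ℝ := x - Pi.single i (displacement σ i r t) with hy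
  set k : ℝ → ℝ := fun s =>
    b s (f s (y - Pi.single i (displacement σ i s r))) i * weight σ h i s r (y i) with hk
  have hkc : Continuous k := (hb.continuous_mildIntegrand h hf i).comp
      (by fun_prop : Continuous fun s : ℝ => (s, r, y))
  have hfac : (fun q => f q (x + displacement σ i t q • e) i) = fun q =>
      weight σ h i r q (x i + displacement σ i t q) * (α i + ∫ s in r..q, k s) := by
    funext q
    rw [mild_eq_weight_mul hmild]
    have h1 : x + displacement σ i t q • e - Pi.single i (displacement σ i r q) = y := by
      have h2 : displacement σ i t q • e = Pi.single i (displacement σ i t q) := by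
        rw [he, ← Pi.single_smul, smul_eq_mul, mul_one]
      rw [h2, hy, ← displacement_add σ i r t q, Pi.single_add]
      abel
    rw [h1]
    simp [he, hk]
  have hw : HasDerivAt (fun q => weight σ h i r q (x i + displacement σ i t q))
      (weight σ h i r t (x i) * (σ i t * (x i / h))) t := by
    have h1 := hb.hasDerivAt_displacement i r t
    have h2 := ((((hdisp.const_add (x i)).mul h1).sub ((h1.pow 2).div_const 2)).div_const h).exp
    refine h2.congr_deriv ?_
    simp [weight]
    ring
  have hp : HasDerivAt (fun q => α i + ∫ s in r..q, k s) (k t) t :=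
    (intervalIntegral.integral_hasDerivAt_right (hkc.intervalIntegrable _ _)
      hkc.stronglyMeasurable.stronglyMeasurableAtFilter hkc.continuousAt).const_add _
  rw [hfac] at hchar
  have hu := hchar.unique (hw.mul hp)
  have hkt : weight σ h i r t (x i) * k t = b t (f t x) i := by
    have h1 := weight_mul σ h i t r t (x i)
    rw [weight_self] at h1
    have h2 : y - Pi.single i (displacement σ i t r) = x := by
      rw [hy, sub_sub, ← Pi.single_add, displacement_add, displacement_self]
      simp
    have h3 : y i = x i - displacement σ i r t := by simp [hy]
    simp only [hk]
    rw [h2, h3]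
    linear_combination b t (f t x) i * h1
  have hft : f t x i = weight σ h i r t (x i) * (α i + ∫ s in r..t, k s) :=
    mild_eq_weight_mul hmild t x i
  have hsplit : L (1, σ i t • e) = L (1, 0) + σ i t * L (0, e) := by
    rw [← smul_eq_mul, ← map_smul, ← map_add]
    simp
  refine ht.congr_deriv ?_
  rw [hx]
  simp only [displacement_self, add_zero] at hu
  linear_combination hu - hsplit + hkt - σ i t * (x i / h) * hft

end GlobalCoefficients

end Regularity

section Concatenation

variable {d N : ℕ} {b : ℝ → (Fin d → ℝ) → Fin d → ℝ}
  {b' : Fin d → ℝ → (Fin d → ℝ) → Fin d → ℝ} {σ : Fin d → ℝ → ℝ} {S : ℝ}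

/-! ### Concatenation over the partition intervals -/

/-- The time `t` clamped to the `k`-th partition interval. -/
def clamp (τ : Fin (N + 1) → ℝ) (k : Fin N) (t : ℝ) : ℝ :=
  max (τ k.castSucc) (min t (τ k.succ))

theorem continuous_clamp (τ : Fin (N + 1) → ℝ) (k : Fin N) : Continuous (clamp τ k) := by
  unfold clamp; fun_prop

section Clamp

variable {τ : Fin (N + 1) → ℝ}

theorem clamp_of_le {k : Fin N} {t : ℝ} (h : t ≤ τ k.castSucc) : clamp τ k t = τ k.castSucc :=
  max_eq_left ((min_le_left _ _).trans h)

theorem clamp_of_ge (hτ : StrictMono τ) {k : Fin N} {t : ℝ} (h : τ k.succ ≤ t) :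
    clamp τ k t = τ k.succ := by
  rw [clamp, min_eq_right h, max_eq_right (hτ Fin.castSucc_lt_succ).le]

theorem clamp_of_mem {k : Fin N} {t : ℝ} (h : t ∈ Icc (τ k.castSucc) (τ k.succ)) :
    clamp τ k t = t := by
  rw [clamp, min_eq_left h.2, max_eq_right h.1]

theorem succ_le_castSucc (hτ : StrictMono τ) {j k : Fin N} (h : j < k) :
    τ j.succ ≤ τ k.castSucc :=
  hτ.monotone (Fin.succ_le_castSucc_iff.2 h)

theorem castSucc_le (hτ : StrictMono τ) {j k : Fin N} (h : j ≤ k) :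
    τ j.castSucc ≤ τ k.castSucc :=
  hτ.monotone (Fin.castSucc_le_castSucc_iff.2 h)

end Clamp

/-- The composition over the first `n` partition intervals of the flows `u k`, each run up to the
clamped time and fed with the `k`-th increment `ξ k`. An interval that lies after `t` contributes
the identity. -/
def partialState (u : Fin N → (Fin d → ℝ) → ℝ → (Fin d → ℝ) → Fin d → ℝ) (τ : Fin (N + 1) → ℝ)
    (c : Fin d → ℝ) : ℕ → ℝ → (Fin N → Fin d → ℝ) → Fin d → ℝ
  | 0, _, _ => c
  | n + 1, t, ξ => if h : n < N then
      u ⟨n, h⟩ (partialState u τ c n t ξ) (clamp τ ⟨n, h⟩ t) (ξ ⟨n, h⟩)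
    else partialState u τ c n t ξ

/-- The concatenated flow at time `t`, as a function of the increments `ξ` of the path over the
partition intervals. -/
def state (u : Fin N → (Fin d → ℝ) → ℝ → (Fin d → ℝ) → Fin d → ℝ) (τ : Fin (N + 1) → ℝ)
    (c : Fin d → ℝ) (t : ℝ) (ξ : Fin N → Fin d → ℝ) : Fin d → ℝ :=
  partialState u τ c N t ξ

section State

variable {u : Fin N → (Fin d → ℝ) → ℝ → (Fin d → ℝ) → Fin d → ℝ} {τ : Fin (N + 1) → ℝ}
  {c : Fin d → ℝ}

theorem continuous_partialState
    (hu : ∀ k, Continuous fun q : (Fin d → ℝ) × ℝ × (Fin d → ℝ) => u k q.1 q.2.1 q.2.2) (n : ℕ) :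
    Continuous fun q : ℝ × (Fin N → Fin d → ℝ) => partialState u τ c n q.1 q.2 := by
  induction n with
  | zero => exact continuous_const
  | succ n ih =>
    by_cases h : n < N
    · simp only [partialState, h, dif_pos]
      exact (hu ⟨n, h⟩).comp (ih.prodMk (((continuous_clamp τ _).comp continuous_fst).prodMk
        (by fun_prop)))
    · simpa only [partialState, h, dif_neg, not_false_eq_true] using ih

theorem partialState_eq_of_ge (hτ : StrictMono τ) (k : Fin N) {t : ℝ} (ht : τ k.castSucc ≤ t)
    (ξ : Fin N → Fin d → ℝ) (n : ℕ) (hn : n ≤ k) :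
    partialState u τ c n t ξ = partialState u τ c n (τ k.castSucc) ξ := by
  induction n with
  | zero => rfl
  | succ n ih =>
    have h : n < N := (Nat.lt_of_succ_le hn).trans k.2
    have hj : τ (Fin.succ ⟨n, h⟩) ≤ τ k.castSucc := succ_le_castSucc hτ (Fin.lt_def.2 hn)
    simp only [partialState, h, dif_pos]
    rw [ih (Nat.le_of_succ_le hn), clamp_of_ge hτ (hj.trans ht), clamp_of_ge hτ hj]

theorem partialState_eq_of_le (hτ : StrictMono τ) (hu0 : ∀ k α x, u k α (τ k.castSucc) x = α)
    (k : Fin N) {t : ℝ} (ht : t ≤ τ k.succ) (ξ : Fin N → Fin d → ℝ) (n : ℕ) (hn : k + 1 ≤ n) :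
    partialState u τ c n t ξ = partialState u τ c (k + 1) t ξ := by
  induction n, hn using Nat.le_induction with
  | base => rfl
  | succ n hn ih =>
    by_cases h : n < N
    · have hj : τ k.succ ≤ τ (Fin.castSucc ⟨n, h⟩) := succ_le_castSucc hτ (Fin.lt_def.2 hn)
      rw [partialState]
      simp only [h, dif_pos]
      rw [clamp_of_le (ht.trans hj), hu0, ih]
    · rw [partialState]
      simp only [h, dif_neg, not_false_eq_true]
      exact ih

theorem state_eq_partialState (hτ : StrictMono τ) (hu0 : ∀ k α x, u k α (τ k.castSucc) x = α)
    (k : Fin N) {t : ℝ} (ht : t ∈ Icc (τ k.castSucc) (τ k.succ)) (ξ : Fin N → Fin d → ℝ) :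
    state u τ c t ξ = u k (partialState u τ c k (τ k.castSucc) ξ) t (ξ k) := by
  rw [state, partialState_eq_of_le hτ hu0 k ht.2 ξ N k.2, partialState]
  simp only [k.2, dif_pos, Fin.eta]
  rw [clamp_of_mem ht, partialState_eq_of_ge hτ k ht.1 ξ k le_rfl]

theorem state_partition (hτ : StrictMono τ) (hu0 : ∀ k α x, u k α (τ k.castSucc) x = α)
    (k : Fin N) (ξ : Fin N → Fin d → ℝ) :
    state u τ c (τ k.castSucc) ξ = partialState u τ c k (τ k.castSucc) ξ := by
  rw [state_eq_partialState hτ hu0 k ⟨le_rfl, (hτ Fin.castSucc_lt_succ).le⟩, hu0]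

theorem state_eq (hτ : StrictMono τ) (hu0 : ∀ k α x, u k α (τ k.castSucc) x = α)
    (k : Fin N) {t : ℝ} (ht : t ∈ Icc (τ k.castSucc) (τ k.succ)) (ξ : Fin N → Fin d → ℝ) :
    state u τ c t ξ = u k (state u τ c (τ k.castSucc) ξ) t (ξ k) := by
  rw [state_eq_partialState hτ hu0 k ht, state_partition hτ hu0]

theorem state_initial (hτ : StrictMono τ) (hu0 : ∀ k α x, u k α (τ k.castSucc) x = α)
    (ξ : Fin N → Fin d → ℝ) : state u τ c (τ 0) ξ = c := by
  cases N with
  | zero => rfl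
  | succ N => exact state_partition hτ hu0 0 ξ

/-- The state at time `t` depends only on the increments over intervals that start before `t`. -/
theorem state_congr (hu0 : ∀ k α x, u k α (τ k.castSucc) x = α) {t : ℝ}
    {ξ ξ' : Fin N → Fin d → ℝ} (h : ∀ j : Fin N, τ j.castSucc < t → ξ j = ξ' j) :
    state u τ c t ξ = state u τ c t ξ' := by
  suffices ∀ n, partialState u τ c n t ξ = partialState u τ c n t ξ' from this N
  intro n
  induction n with
  | zero => rfl
  | succ n ih =>
    by_cases hn : n < N
    · simp only [partialState, hn, dif_pos]
      rcases lt_or_ge (τ (Fin.castSucc ⟨n, hn⟩)) t with hj | hj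
      · rw [ih, h _ hj]
      · rw [clamp_of_le hj, hu0, hu0, ih]
    · simpa only [partialState, hn, dif_neg, not_false_eq_true] using ih

/-- The stochastic exponential `ℰ_i^π(s,t)` as a function of the increments. -/
def pathWeight (σ : Fin d → ℝ → ℝ) (τ : Fin (N + 1) → ℝ) (i : Fin d) (s t : ℝ)
    (ξ : Fin N → Fin d → ℝ) : ℝ :=
  ∏ k, weight σ (len τ k) i (clamp τ k s) (clamp τ k t) (ξ k i)

/-- The effect on the increments of translating the path by `-shift τ σ i s t`. -/
def pathShift (σ : Fin d → ℝ → ℝ) (τ : Fin (N + 1) → ℝ) (i : Fin d) (s t : ℝ)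
    (ξ : Fin N → Fin d → ℝ) (k : Fin N) : Fin d → ℝ :=
  ξ k - Pi.single i (displacement σ i (clamp τ k s) (clamp τ k t))

theorem pathWeight_self (σ : Fin d → ℝ → ℝ) (τ : Fin (N + 1) → ℝ) (i : Fin d) (t : ℝ)
    (ξ : Fin N → Fin d → ℝ) : pathWeight σ τ i t t ξ = 1 := by
  simp [pathWeight]

theorem pathWeight_eq_weight (hτ : StrictMono τ) (k : Fin N) {s t : ℝ}
    (hs : s ∈ Icc (τ k.castSucc) (τ k.succ)) (ht : t ∈ Icc (τ k.castSucc) (τ k.succ)) (i : Fin d)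
    (ξ : Fin N → Fin d → ℝ) : pathWeight σ τ i s t ξ = weight σ (len τ k) i s t (ξ k i) := by
  rw [pathWeight, Finset.prod_eq_single k, clamp_of_mem hs, clamp_of_mem ht]
  · intro j _ hj
    rcases lt_or_gt_of_ne hj with h | h
    · have := succ_le_castSucc hτ h
      rw [clamp_of_ge hτ (this.trans hs.1), clamp_of_ge hτ (this.trans ht.1), weight_self]
    · have := succ_le_castSucc hτ h
      rw [clamp_of_le (hs.2.trans this), clamp_of_le (ht.2.trans this), weight_self]
  · exact fun h => absurd (Finset.mem_univ k) h

theorem pathWeight_mul (hτ : StrictMono τ) (k : Fin N) {s t : ℝ} (hs : s ≤ τ k.castSucc)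
    (ht : τ k.castSucc ≤ t) (i : Fin d) (ξ : Fin N → Fin d → ℝ) :
    pathWeight σ τ i s (τ k.castSucc) ξ * pathWeight σ τ i (τ k.castSucc) t ξ
      = pathWeight σ τ i s t ξ := by
  simp only [pathWeight]
  rw [← Finset.prod_mul_distrib]
  refine Finset.prod_congr rfl fun j _ => ?_
  rw [← weight_mul σ (len τ j) i (clamp τ j s) (clamp τ j (τ k.castSucc)) (clamp τ j t), mul_comm]
  congr 1
  rcases lt_or_ge j k with h | h
  · have := succ_le_castSucc hτ h
    rw [clamp_of_ge hτ (this.trans ht), clamp_of_ge hτ this, displacement_self, sub_zero]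
  · have := castSucc_le hτ h
    rw [clamp_of_le (hs.trans this), clamp_of_le this, weight_self, weight_self]

theorem continuous_mildStateIntegrand (hb : GlobalCoefficients b b' σ S)
    (hu : ∀ k, Continuous fun q : (Fin d → ℝ) × ℝ × (Fin d → ℝ) => u k q.1 q.2.1 q.2.2)
    (t : ℝ) (ξ : Fin N → Fin d → ℝ) (i : Fin d) :
    Continuous fun s => b s (state u τ c s (pathShift σ τ i s t ξ)) i * pathWeight σ τ i s t ξ := by
  have h1 : ∀ k, Continuous fun s => displacement σ i (clamp τ k s) (clamp τ k t) := fun k =>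
    (hb.continuous_displacement i).comp ((continuous_clamp τ k).prodMk continuous_const)
  have h2 : Continuous fun s => pathShift σ τ i s t ξ := continuous_pi fun k =>
    continuous_const.sub ((continuous_single (A := fun _ : Fin d => ℝ) i).comp (h1 k))
  have h3 : Continuous fun s => state u τ c s (pathShift σ τ i s t ξ) :=
    (continuous_partialState hu N).comp (continuous_id.prodMk h2)
  have h4 : Continuous fun s => pathWeight σ τ i s t ξ := continuous_finsetProd _ fun k _ =>
    (hb.continuous_weight (len τ k) i).comp
      ((continuous_clamp τ k).prodMk (continuous_const (y := (clamp τ k t, ξ k i))))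
  exact ((continuous_apply i).comp (hb.b_cont.comp (continuous_id.prodMk h3))).mul h4

/-- The mild equation over several partition intervals. Passing to the next interval multiplies the
equation by the weight of that interval, and neither the earlier states nor the earlier translations
see the new increment. -/
theorem state_mild (hb : GlobalCoefficients b b' σ S) (hτ : StrictMono τ)
    (hu : ∀ k, Continuous fun q : (Fin d → ℝ) × ℝ × (Fin d → ℝ) => u k q.1 q.2.1 q.2.2)
    (hmild : ∀ k α, IsMildPDESolution b σ (len τ k) (τ k.castSucc) α (u k α))
    (hu0 : ∀ k α x, u k α (τ k.castSucc) x = α) (n : Fin (N + 1)) :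
    ∀ t ∈ Icc (τ 0) (τ n), ∀ ξ i, state u τ c t ξ i = c i * pathWeight σ τ i (τ 0) t ξ +
      ∫ s in (τ 0)..t, b s (state u τ c s (pathShift σ τ i s t ξ)) i * pathWeight σ τ i s t ξ := by
  induction n using Fin.induction with
  | zero =>
    intro t ht ξ i
    obtain rfl : t = τ 0 := le_antisymm ht.2 ht.1
    rw [state_initial hτ hu0, pathWeight_self]
    simp
  | succ k ih =>
    intro t ht ξ i
    rcases le_total t (τ k.castSucc) with htk | htk
    · exact ih t ⟨ht.1, htk⟩ ξ i
    have h0k : τ 0 ≤ τ k.castSucc := hτ.monotone (Fin.zero_le _)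
    have htI : t ∈ Icc (τ k.castSucc) (τ k.succ) := ⟨htk, ht.2⟩
    have hrI : τ k.castSucc ∈ Icc (τ k.castSucc) (τ k.succ) :=
      ⟨le_rfl, (hτ Fin.castSucc_lt_succ).le⟩
    have hc := continuous_mildStateIntegrand (c := c) (τ := τ) hb hu t ξ i
    rw [state_eq hτ hu0 k htI, hmild k _ t (ξ k) i, ih _ ⟨h0k, le_rfl⟩ ξ i,
      ← pathWeight_eq_weight hτ k hrI htI, add_mul, mul_assoc, pathWeight_mul hτ k h0k htk,
      ← intervalIntegral.integral_mul_const, add_assoc,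
      ← intervalIntegral.integral_add_adjacent_intervals (hc.intervalIntegrable _ (τ k.castSucc))
        (hc.intervalIntegrable _ _)]
    congr 2
    · refine intervalIntegral.integral_congr fun s hs => ?_
      rw [uIcc_of_le h0k] at hs
      have h1 : state u τ c s (pathShift σ τ i s (τ k.castSucc) ξ)
          = state u τ c s (pathShift σ τ i s t ξ) := by
        refine state_congr hu0 fun j hj => ?_
        have hjk : j < k := by
          by_contra hjk
          exact absurd (hj.trans_le hs.2) (not_lt.2 (castSucc_le hτ (not_lt.1 hjk)))
        have := succ_le_castSucc hτ hjk
        rw [pathShift, pathShift, clamp_of_ge hτ this, clamp_of_ge hτ (this.trans htk)]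
      simp only [h1]
      rw [mul_assoc, pathWeight_mul hτ k hs.2 htk]
    · refine intervalIntegral.integral_congr fun s hs => ?_
      rw [uIcc_of_le htk] at hs
      have hsI : s ∈ Icc (τ k.castSucc) (τ k.succ) := ⟨hs.1, hs.2.trans ht.2⟩
      rw [pathWeight_eq_weight hτ k hsI htI, state_eq hτ hu0 k hsI]
      have h1 : state u τ c (τ k.castSucc) (pathShift σ τ i s t ξ)
          = state u τ c (τ k.castSucc) ξ := by
        refine state_congr hu0 fun j hj => ?_
        have hjk : j < k := by
          by_contra hjk
          exact absurd hj (not_lt.2 (castSucc_le hτ (not_lt.1 hjk)))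
        have := succ_le_castSucc hτ hjk
        rw [pathShift, clamp_of_ge hτ (this.trans hs.1), clamp_of_ge hτ (this.trans htk),
          displacement_self, Pi.single_zero, sub_zero]
      rw [h1, pathShift, clamp_of_mem hsI, clamp_of_mem htI]

end State

/-! ### Extension of the coefficients to all times -/

/-- Regular coefficients on `[0,T]` extend to all times, by freezing them outside `[0,T]`. -/
theorem RegularCoefficients.exists_global {T : ℝ} (hT : 0 < T)
    (hbσ : RegularCoefficients T b σ) :
    ∃ (B : ℝ → (Fin d → ℝ) → Fin d → ℝ) (B' : Fin d → ℝ → (Fin d → ℝ) → Fin d → ℝ)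
      (s : Fin d → ℝ → ℝ) (S : ℝ), GlobalCoefficients B B' s S ∧
      (∀ t ∈ Icc 0 T, B t = b t) ∧ (∀ i, ∀ t ∈ Icc 0 T, s i t = σ i t) ∧
      ∃ M, ∀ t x, ‖B t x‖ ≤ M := by
  set p : ℝ → ℝ := fun t => projIcc 0 T hT.le t with hp
  have hpm : ∀ t, p t ∈ Icc 0 T := fun t => (projIcc 0 T hT.le t).2
  have hpc : Continuous p := continuous_subtype_val.comp continuous_projIcc
  have hpe : ∀ t ∈ Icc 0 T, p t = t := fun t ht => by simp [hp, projIcc_of_mem hT.le ht]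
  have hcont : ∀ g : ℝ × (Fin d → ℝ) → Fin d → ℝ, ContinuousOn g (Icc 0 T ×ˢ univ) →
      Continuous fun q : ℝ × (Fin d → ℝ) => g (p q.1, q.2) := fun g hg =>
    hg.comp_continuous (by fun_prop) fun q => ⟨hpm _, mem_univ _⟩
  obtain ⟨M, hM⟩ := hbσ.b_bdd
  choose Mσ hMσ using hbσ.σ_bdd
  refine ⟨fun t => b (p t), fun j t x => lineDeriv ℝ (b (p t)) x (Pi.single j 1),
    fun i t => σ i (p t), 1 + ∑ i, max (Mσ i) 0, ?_, fun t ht => congrArg b (hpe t ht),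
    fun i t ht => congrArg (σ i) (hpe t ht), M, fun t x => hM _ (hpm t) x⟩
  have h0 : ∀ i, 0 ≤ max (Mσ i) 0 := fun i => le_max_right _ _
  exact
    { b_cont := hcont _ hbσ.b_cont
      b'_cont := fun j => hcont _ (hbσ.db_cont j)
      b'_bdd := fun j => by
        obtain ⟨M', hM'⟩ := hbσ.db_bdd j
        exact ⟨M', fun t x => hM' _ (hpm t) x⟩
      hasLineDerivAt := fun j t x => (hbσ.b_diff j _ (hpm t) x).hasLineDerivAt
      σ_cont := fun i => (hbσ.σ_cont i).comp_continuous hpc hpm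
      σ_bdd := fun i t => by
        refine (hMσ i _ (hpm t)).trans ((le_max_left _ 0).trans ?_)
        have := Finset.single_le_sum (f := fun i => max (Mσ i) 0) (fun i _ => h0 i)
          (Finset.mem_univ i)
        linarith
      one_le := by
        have := Finset.sum_nonneg fun i (_ : i ∈ Finset.univ) => h0 i
        linarith }

/-- A mild solution for coefficients that agree with `b`, `σ` on `[0,T]` is a classical solution on
subintervals of `[0,T]`. -/
theorem GlobalCoefficients.isClassicalSolution {B : ℝ → (Fin d → ℝ) → Fin d → ℝ}
    {s : Fin d → ℝ → ℝ} {T : ℝ} (hb : GlobalCoefficients B b' s S)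
    (hB : ∀ t ∈ Icc 0 T, B t = b t) (hs : ∀ i, ∀ t ∈ Icc 0 T, s i t = σ i t) {h r R : ℝ}
    (hr : 0 ≤ r) (hrR : r < R) (hR : R ≤ T) {α : Fin d → ℝ} {f : ℝ → (Fin d → ℝ) → Fin d → ℝ}
    (hf : Continuous fun q : ℝ × (Fin d → ℝ) => f q.1 q.2) (hmild : IsMildPDESolution B s h r α f) :
    IsClassicalSolution b σ h r R α f where
  contDiffOn := (hb.contDiff_mild hf hmild).contDiffOn
  initial x := by
    funext i
    rw [hmild r x i]
    simp
  pde t ht x i := by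
    have htT : t ∈ Icc 0 T := ⟨hr.trans ht.1.le, ht.2.trans hR⟩
    rw [(hb.mild_pde hf hmild t x i).hasDerivWithinAt.derivWithin
      (uniqueDiffOn_Icc hrR t ⟨ht.1.le, ht.2⟩), hB t htT, hs i t htT]

end Concatenation

section Noise

variable {d N : ℕ} {T : ℝ} {b : ℝ → (Fin d → ℝ) → Fin d → ℝ}
  {b' : Fin d → ℝ → (Fin d → ℝ) → Fin d → ℝ} {σ ς : Fin d → ℝ → ℝ} {S : ℝ}
  {τ : Fin (N + 1) → ℝ}

/-! ### The noise in terms of the increments -/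

/-- The increments of the path over the partition intervals. -/
def increment (τ : Fin (N + 1) → ℝ) (ω : PathSpace T d) (k : Fin N) : Fin d → ℝ :=
  B (τ k.succ) ω - B (τ k.castSucc) ω

theorem measurable_B (t : ℝ) : Measurable (B t : PathSpace T d → Fin d → ℝ) := by
  by_cases h : t ∈ Icc (0 : ℝ) T
  · have e : (B t : PathSpace T d → Fin d → ℝ) = fun ω => ω ⟨t, h⟩ := by
      funext ω; simp only [B, h, dif_pos]
    rw [e]
    exact (measurable_pi_apply (⟨t, h⟩ : Icc (0 : ℝ) T)).comp (comap_measurable _)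
  · have e : (B t : PathSpace T d → Fin d → ℝ) = fun _ => 0 := by
      funext ω; simp only [B, h, dif_neg, not_false_eq_true]
    rw [e]
    exact measurable_const

theorem B_of_mem {t : ℝ} (h : t ∈ Icc (0 : ℝ) T) (ω : PathSpace T d) : B t ω = ω ⟨t, h⟩ := by
  simp only [B, h, dif_pos]

theorem measurable_increment (τ : Fin (N + 1) → ℝ) :
    Measurable (increment τ : PathSpace T d → Fin N → Fin d → ℝ) :=
  measurable_pi_iff.2 fun _ => (measurable_B _).sub (measurable_B _)

namespace IsPartition

theorem mem_Icc (hτ : IsPartition T τ) (n : Fin (N + 1)) : τ n ∈ Icc 0 T := by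
  rw [← hτ.zero, ← hτ.last]
  exact ⟨hτ.strictMono.monotone (Fin.zero_le _), hτ.strictMono.monotone (Fin.le_last _)⟩

theorem len_pos (hτ : IsPartition T τ) (k : Fin N) : 0 < len τ k :=
  sub_pos.2 (hτ.strictMono Fin.castSucc_lt_succ)

theorem exists_mem_Ioo (hτ : IsPartition T τ) {r : ℝ} (h0 : 0 < r) (hT : r < T)
    (hr : ∀ n, r ≠ τ n) : ∃ k : Fin N, r ∈ Ioo (τ k.castSucc) (τ k.succ) := by
  suffices ∀ n : Fin (N + 1), r < τ n → ∃ k : Fin N, r ∈ Ioo (τ k.castSucc) (τ k.succ) from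
    this (Fin.last N) (by rwa [hτ.last])
  intro n
  induction n using Fin.induction with
  | zero => intro h; rw [hτ.zero] at h; exact absurd h h0.not_gt
  | succ k ih =>
    intro h
    rcases lt_or_ge r (τ k.castSucc) with h1 | h1
    · exact ih h1
    · exact ⟨k, lt_of_le_of_ne h1 (hr _).symm, h⟩

end IsPartition

/-- On `]t_k, t_{k+1}[` the polygonal path has slope `ξ_k / h_k`. -/
theorem deriv_polygonal (hτ : IsPartition T τ) (k : Fin N) {r : ℝ}
    (hr : r ∈ Ioo (τ k.castSucc) (τ k.succ)) (ω : PathSpace T d) (i : Fin d) :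
    deriv (fun q => polygonal τ ω q i) r = increment τ ω k i / len τ k := by
  have hev : (fun q => polygonal τ ω q i) =ᶠ[𝓝 r] fun q =>
      (1 - (q - τ k.castSucc) / len τ k) * B (τ k.castSucc) ω i
        + ((q - τ k.castSucc) / len τ k) * B (τ k.succ) ω i := by
    filter_upwards [isOpen_Ioo.mem_nhds hr] with q hq
    have hqT : q ≠ T := (hq.2.trans_le (hτ.mem_Icc _).2).ne
    rw [polygonal, if_neg hqT, Finset.sum_eq_single k]
    · rw [indicator_of_mem (show q ∈ Ico (τ k.castSucc) (τ k.succ) from ⟨hq.1.le, hq.2⟩)]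
      simp
    · intro j _ hj
      refine indicator_of_notMem (fun hm => ?_) _
      rcases lt_or_gt_of_ne hj with h | h
      · have := succ_le_castSucc hτ.strictMono h
        linarith [hm.2, hq.1]
      · have := succ_le_castSucc hτ.strictMono h
        linarith [hm.1, hq.2]
    · exact fun h => absurd (Finset.mem_univ k) h
  rw [hev.deriv_eq]
  have h1 : HasDerivAt (fun q => (q - τ k.castSucc) / len τ k) (1 / len τ k) r :=
    ((hasDerivAt_id' r).sub_const _).div_const _
  have h2 := ((h1.const_sub 1).mul_const (B (τ k.castSucc) ω i)).add
    (h1.mul_const (B (τ k.succ) ω i))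
  refine (HasDerivAt.deriv h2).trans ?_
  simp only [increment, Pi.sub_apply]
  ring

theorem integral_indicator_Icc {a c s t : ℝ} (hst : s ≤ t) (f : ℝ → ℝ) :
    ∫ r in s..t, (Icc a c).indicator f r = ∫ r in max a (min s c)..max a (min t c), f r := by
  have h1 : max a (min s c) ≤ max a (min t c) := max_le_max_left _ (min_le_min_right _ hst)
  rw [intervalIntegral.integral_of_le hst, intervalIntegral.integral_of_le h1,
    setIntegral_indicator measurableSet_Icc]
  have h2 : (Ioc s t ∩ Icc a c : Set ℝ) =ᵐ[volume] (Ioc s t ∩ Ioc a c : Set ℝ) :=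
    (ae_eq_refl _).inter Ioc_ae_eq_Icc.symm
  rw [setIntegral_congr_set h2]
  congr 2
  ext x
  simp only [mem_inter_iff, mem_Ioc, max_lt_iff, min_lt_iff, le_max_iff, le_min_iff]
  constructor
  · rintro ⟨⟨h3, h4⟩, h5, h6⟩
    exact ⟨⟨h5, Or.inl h3⟩, Or.inr ⟨h4, h6⟩⟩
  · rintro ⟨⟨h3, h4⟩, h5⟩
    have h6 : x ≤ t ∧ x ≤ c := h5.resolve_left h3.not_ge
    exact ⟨⟨h4.resolve_right h6.2.not_gt, h6.1⟩, h3, h6.2⟩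

theorem sigmaInt_eq (hb : GlobalCoefficients b b' ς S) (hς : ∀ i, ∀ t ∈ Icc 0 T, ς i t = σ i t)
    (i : Fin d) (k : Fin N) {s t : ℝ} (hs : 0 ≤ s) (hst : s ≤ t) (ht : t ≤ T) :
    sigmaInt τ σ i k s t = displacement ς i (clamp τ k s) (clamp τ k t) := by
  have h1 : sigmaInt τ σ i k s t
      = ∫ r in s..t, (Icc (τ k.castSucc) (τ k.succ)).indicator (ς i) r := by
    refine intervalIntegral.integral_congr fun r hr => ?_
    rw [uIcc_of_le hst] at hr
    by_cases h : r ∈ Icc (τ k.castSucc) (τ k.succ)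
    · simp only [indicator_of_mem h, hς i r ⟨hs.trans hr.1, hr.2.trans ht⟩]
    · simp only [indicator_of_notMem h]
  rw [h1, integral_indicator_Icc hst, hb.displacement_eq,
    clamp, clamp]

theorem noiseIntegral_eq (hb : GlobalCoefficients b b' ς S)
    (hς : ∀ i, ∀ t ∈ Icc 0 T, ς i t = σ i t) (hτ : IsPartition T τ) (i : Fin d) {s t : ℝ}
    (hs : 0 ≤ s) (hst : s ≤ t) (ht : t ≤ T) (ω : PathSpace T d) :
    noiseIntegral τ σ i s t ω = ∑ k, displacement ς i (clamp τ k s) (clamp τ k t) / len τ k *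
      increment τ ω k i := by
  have h1 : noiseIntegral τ σ i s t ω = ∫ r in s..t, ∑ k,
      (Icc (τ k.castSucc) (τ k.succ)).indicator (ς i) r * (increment τ ω k i / len τ k) := by
    refine intervalIntegral.integral_congr_ae ?_
    have hfin : (range τ ∪ {T} : Set ℝ).Finite := (finite_range τ).union (finite_singleton T)
    filter_upwards [hfin.countable.ae_notMem volume] with r hr hrI
    rw [uIoc_of_le hst] at hrI
    have hr0 : 0 < r := hs.trans_lt hrI.1
    have hrT : r < T := lt_of_le_of_ne (hrI.2.trans ht) fun h => hr (Or.inr h)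
    obtain ⟨k, hk⟩ := hτ.exists_mem_Ioo hr0 hrT fun n h => hr (Or.inl ⟨n, h.symm⟩)
    rw [deriv_polygonal hτ k hk, Finset.sum_eq_single k,
      indicator_of_mem (show r ∈ Icc (τ k.castSucc) (τ k.succ) from ⟨hk.1.le, hk.2.le⟩),
      hς i r ⟨hr0.le, hrT.le⟩]
    · intro j _ hj
      rw [indicator_of_notMem, zero_mul]
      intro hm
      rcases lt_or_gt_of_ne hj with h | h
      · have := succ_le_castSucc hτ.strictMono h
        linarith [hm.2, hk.1]
      · have := succ_le_castSucc hτ.strictMono h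
        linarith [hm.1, hk.2]
    · exact fun h => absurd (Finset.mem_univ k) h
  rw [h1, intervalIntegral.integral_finsetSum]
  · refine Finset.sum_congr rfl fun k _ => ?_
    rw [intervalIntegral.integral_mul_const,
      integral_indicator_Icc hst, hb.displacement_eq,
      clamp, clamp]
    ring
  · intro k _
    have h2 := (hb.σ_cont i).intervalIntegrable (μ := volume) s t
    exact IntervalIntegrable.mul_const
      ⟨h2.1.indicator measurableSet_Icc, h2.2.indicator measurableSet_Icc⟩ _

/-- Translating the path by `-shift τ σ i s t` moves the `k`-th increment by
`-∫_{[s,t] ∩ [t_k,t_{k+1}]} σ_i`. -/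
theorem increment_sub_shift (hb : GlobalCoefficients b b' ς S)
    (hς : ∀ i, ∀ t ∈ Icc 0 T, ς i t = σ i t) (hτ : IsPartition T τ) (i : Fin d) {s t : ℝ}
    (hs : 0 ≤ s) (hst : s ≤ t) (ht : t ≤ T) (ω : PathSpace T d) :
    increment τ (ω - shift τ σ i s t) = pathShift ς τ i s t (increment τ ω) := by
  funext k
  have hq : ∀ n : Fin (N + 1), (shift τ σ i s t : PathSpace T d) ⟨τ n, hτ.mem_Icc n⟩ =
      Pi.single i (∑ j : Fin N, displacement ς i (clamp τ j s) (clamp τ j t) / len τ j *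
        (clamp τ j (τ n) - clamp τ j 0)) := by
    intro n
    change Pi.single i _ = _
    congr 1
    refine Finset.sum_congr rfl fun j _ => ?_
    rw [sigmaInt_eq hb hς i j hs hst ht,
      integral_indicator_Icc (hτ.mem_Icc n).1,
      intervalIntegral.integral_const, smul_eq_mul, mul_one]
    rfl
  have hdiff : (∑ j : Fin N, displacement ς i (clamp τ j s) (clamp τ j t) / len τ j *
        (clamp τ j (τ k.succ) - clamp τ j 0))
      - (∑ j : Fin N, displacement ς i (clamp τ j s) (clamp τ j t) / len τ j *
        (clamp τ j (τ k.castSucc) - clamp τ j 0))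
      = displacement ς i (clamp τ k s) (clamp τ k t) := by
    rw [← Finset.sum_sub_distrib, Finset.sum_eq_single k]
    · rw [← mul_sub, sub_sub_sub_cancel_right, clamp_of_ge hτ.strictMono le_rfl,
        clamp_of_le le_rfl]
      change _ / len τ k * len τ k = _
      exact div_mul_cancel₀ _ (hτ.len_pos k).ne'
    · intro j _ hj
      rw [← mul_sub, sub_sub_sub_cancel_right]
      have hk := (hτ.strictMono (Fin.castSucc_lt_succ (i := k))).le
      rcases lt_or_gt_of_ne hj with h | h
      · have := succ_le_castSucc hτ.strictMono h
        rw [clamp_of_ge hτ.strictMono (this.trans hk), clamp_of_ge hτ.strictMono this, sub_self,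
          mul_zero]
      · have := succ_le_castSucc hτ.strictMono h
        rw [clamp_of_le this, clamp_of_le (hk.trans this), sub_self, mul_zero]
    · exact fun h => absurd (Finset.mem_univ k) h
  rw [pathShift, increment, increment, B_of_mem (hτ.mem_Icc _), B_of_mem (hτ.mem_Icc _),
    B_of_mem (hτ.mem_Icc _), B_of_mem (hτ.mem_Icc _), ContinuousMap.sub_apply,
    ContinuousMap.sub_apply, hq, hq, sub_sub_sub_comm, ← Pi.single_sub, hdiff]

/-! ### Gaussian moments -/

section Gaussian

variable {P : Measure (PathSpace T d)}

theorem IsWienerMeasure.hasLaw_increment (hP : IsWienerMeasure P) (hτ : IsPartition T τ)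
    (k : Fin N) (i : Fin d) :
    HasLaw (fun ω => increment τ ω k i) (gaussianReal 0 (len τ k).toNNReal) P := by
  have h1 := hP.law ⟨τ k.castSucc, hτ.mem_Icc _⟩ ⟨τ k.succ, hτ.mem_Icc _⟩
    (hτ.strictMono Fin.castSucc_lt_succ).le
  have h2 := (measurePreserving_eval
    (fun _ : Fin d => gaussianReal 0 (len τ k).toNNReal) i).fun_comp_hasLaw h1
  have e : (fun ω : PathSpace T d => increment τ ω k i) = fun ω : PathSpace T d => Function.eval i
      (ω ⟨τ k.succ, hτ.mem_Icc _⟩ - ω ⟨τ k.castSucc, hτ.mem_Icc _⟩) := by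
    funext ω
    rw [increment, B_of_mem (hτ.mem_Icc _), B_of_mem (hτ.mem_Icc _), Function.eval]
  rw [e]
  exact h2

theorem IsWienerMeasure.iIndepFun_increment (hP : IsWienerMeasure P) (hτ : IsPartition T τ)
    (i : Fin d) : iIndepFun (fun (k : Fin N) ω => increment τ ω k i) P := by
  have h1 := hP.indep N (fun n => ⟨τ n, hτ.mem_Icc n⟩) fun m n h => hτ.strictMono.monotone h
  have h2 := h1.comp (fun _ x => x i) fun _ => measurable_pi_apply i
  have e : (fun (k : Fin N) (ω : PathSpace T d) => increment τ ω k i) = fun k =>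
      (fun x : Fin d → ℝ => x i) ∘ fun ω : PathSpace T d =>
        ω ⟨τ k.succ, hτ.mem_Icc _⟩ - ω ⟨τ k.castSucc, hτ.mem_Icc _⟩ := by
    funext k ω
    rw [increment, B_of_mem (hτ.mem_Icc _), B_of_mem (hτ.mem_Icc _), Function.comp]
  rw [e]
  exact h2

theorem measurable_increment_apply (τ : Fin (N + 1) → ℝ) (k : Fin N) (i : Fin d) :
    Measurable fun ω : PathSpace T d => increment τ ω k i :=
  (measurable_pi_apply i).comp ((measurable_pi_apply k).comp (measurable_increment τ))

/-- The variance of a linear combination of increments. -/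
theorem IsWienerMeasure.integral_sq_sum (hP : IsWienerMeasure P) (hτ : IsPartition T τ) (i : Fin d)
    (a : Fin N → ℝ) :
    ∫ ω, (∑ k, a k * increment τ ω k i) ^ 2 ∂P = ∑ k, a k ^ 2 * len τ k := by
  have := hP.prob
  have hmem : ∀ k, MemLp (fun ω => increment τ ω k i) 2 P := fun k => by
    have h1 := hP.hasLaw_increment hτ k i
    have h2 := memLp_id_gaussianReal' (μ := 0) (v := (len τ k).toNNReal) 2 (by simp)
    rw [← h1.map_eq] at h2
    exact (memLp_map_measure_iff aestronglyMeasurable_id h1.aemeasurable).1 h2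
  have hmem' : ∀ k ∈ Finset.univ, MemLp (fun ω => a k * increment τ ω k i) 2 P :=
    fun k _ => (hmem k).const_mul (a k)
  have hmean : ∀ k, ∫ ω, increment τ ω k i ∂P = 0 := fun k => by
    rw [(hP.hasLaw_increment hτ k i).integral_eq, integral_id_gaussianReal]
  have hvar : ∀ k, Var[fun ω => increment τ ω k i; P] = len τ k := fun k => by
    rw [(hP.hasLaw_increment hτ k i).variance_eq, variance_id_gaussianReal,
      Real.coe_toNNReal _ (hτ.len_pos k).le]
  have hsum : (fun ω : PathSpace T d => ∑ k, a k * increment τ ω k i)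
      = ∑ k, fun ω => a k * increment τ ω k i := by
    funext ω; simp
  have h0 : ∫ ω, (∑ k, a k * increment τ ω k i) ∂P = 0 := by
    rw [integral_finsetSum _ fun k hk => (hmem' k hk).integrable (by norm_num)]
    simp [integral_const_mul, hmean]
  have hmeas : AEMeasurable (fun ω : PathSpace T d => ∑ k, a k * increment τ ω k i) P :=
    (Finset.measurable_sum _ fun k _ =>
      (measurable_increment_apply τ k i).const_mul (a k)).aemeasurable
  rw [← variance_of_integral_eq_zero hmeas h0, hsum, IndepFun.variance_sum hmem']
  · exact Finset.sum_congr rfl fun k _ => by rw [variance_const_mul, hvar]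
  · intro j _ k _ hjk
    exact ((hP.iIndepFun_increment hτ i).indepFun hjk).comp
      (measurable_const_mul (a j)) (measurable_const_mul (a k))

theorem wickExp_eq (hb : GlobalCoefficients b b' ς S)
    (hς : ∀ i, ∀ t ∈ Icc 0 T, ς i t = σ i t) (hτ : IsPartition T τ) (hP : IsWienerMeasure P)
    (i : Fin d) {s t : ℝ} (hs : 0 ≤ s) (hst : s ≤ t) (ht : t ≤ T) (ω : PathSpace T d) :
    wickExp P τ σ i s t ω = pathWeight ς τ i s t (increment τ ω) := by
  simp only [wickExp, pathWeight, weight, noiseIntegral_eq hb hς hτ i hs hst ht]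
  rw [hP.integral_sq_sum hτ i, ← Real.exp_sum, Finset.mul_sum, ← Finset.sum_sub_distrib]
  congr 1
  refine Finset.sum_congr rfl fun k _ => ?_
  have := (hτ.len_pos k).ne'
  field_simp

theorem IsWienerMeasure.memLp_exp (hP : IsWienerMeasure P) (hτ : IsPartition T τ) (i : Fin d)
    (S : ℝ) : MemLp (fun ω => Real.exp (S * ∑ k, |increment τ ω k i|)) 2 P := by
  have := hP.prob
  have hmeas : ∀ k, Measurable fun ω : PathSpace T d => |increment τ ω k i| := fun k =>
    (measurable_increment_apply τ k i).norm
  have hm : Measurable fun ω : PathSpace T d => Real.exp (S * ∑ k, |increment τ ω k i|) :=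
    Real.measurable_exp.comp ((Finset.measurable_sum _ fun k _ => hmeas k).const_mul S)
  rw [memLp_two_iff_integrable_sq hm.aestronglyMeasurable]
  have hexp : ∀ k (a : ℝ), Integrable (fun ω => Real.exp (a * increment τ ω k i)) P := fun k a => by
    have h1 := hP.hasLaw_increment hτ k i
    have h2 := integrable_exp_mul_gaussianReal (μ := 0) (v := (len τ k).toNNReal) a
    rw [← h1.map_eq] at h2
    exact h2.comp_aemeasurable h1.aemeasurable
  have h1 := ((hP.iIndepFun_increment hτ i).comp (fun _ x => |x|)
    fun _ => measurable_norm).integrable_exp_mul_sum (t := 2 * S) hmeas (s := Finset.univ)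
    fun k _ => integrable_exp_mul_abs (hexp k _) (hexp k _)
  refine h1.congr (ae_of_all _ fun ω => ?_)
  simp only [Finset.sum_apply, Function.comp]
  rw [← Real.exp_nat_mul]
  congr 1
  push_cast
  ring

end Gaussian

/-! ### Growth of the solution -/

theorem clamp_mem (hτ : IsPartition T τ) (k : Fin N) (t : ℝ) :
    clamp τ k t ∈ Icc (τ k.castSucc) (τ k.succ) :=
  ⟨le_max_left _ _, max_le (hτ.strictMono Fin.castSucc_lt_succ).le (min_le_right _ _)⟩

theorem abs_pathWeight_le (hb : GlobalCoefficients b b' σ S) (hτ : IsPartition T τ) (i : Fin d)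
    (s t : ℝ) (ξ : Fin N → Fin d → ℝ) :
    |pathWeight σ τ i s t ξ| ≤ Real.exp (S * ∑ k, |ξ k i|) := by
  rw [pathWeight, Finset.abs_prod, Finset.mul_sum, Real.exp_sum]
  refine Finset.prod_le_prod (fun k _ => abs_nonneg _) fun k _ => ?_
  rw [weight, Real.abs_exp, Real.exp_le_exp]
  set a := displacement σ i (clamp τ k s) (clamp τ k t) with ha
  have hl := hτ.len_pos k
  have hS : 0 ≤ S := zero_le_one.trans hb.one_le
  have h1 : |a| ≤ S * len τ k := by
    refine (hb.abs_displacement_le i _ _).trans (mul_le_mul_of_nonneg_left ?_ hS)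
    have h2 := clamp_mem hτ k s
    have h3 := clamp_mem hτ k t
    rw [abs_le, len]
    constructor <;> linarith [h2.1, h2.2, h3.1, h3.2]
  rw [div_le_iff₀ hl]
  have h2 : ξ k i * a ≤ |ξ k i| * (S * len τ k) := by
    refine (le_abs_self _).trans ?_
    rw [abs_mul]
    exact mul_le_mul_of_nonneg_left h1 (abs_nonneg _)
  nlinarith [sq_nonneg a]

theorem abs_state_le (hb : GlobalCoefficients b b' σ S) (hτ : IsPartition T τ) {M : ℝ}
    (hM : ∀ t x, ‖b t x‖ ≤ M) {X : ℝ → (Fin N → Fin d → ℝ) → Fin d → ℝ} {c : Fin d → ℝ} {t : ℝ}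
    (ht : t ∈ Icc 0 T) {ξ : Fin N → Fin d → ℝ} {i : Fin d}
    (hX : X t ξ i = c i * pathWeight σ τ i 0 t ξ +
      ∫ s in (0 : ℝ)..t, b s (X s (pathShift σ τ i s t ξ)) i * pathWeight σ τ i s t ξ) :
    |X t ξ i| ≤ (|c i| + M * T) * Real.exp (S * ∑ k, |ξ k i|) := by
  have hM0 : 0 ≤ M := (norm_nonneg _).trans (hM 0 0)
  have hW := fun s => abs_pathWeight_le hb hτ i s t ξ
  have hint : |∫ s in (0 : ℝ)..t, b s (X s (pathShift σ τ i s t ξ)) i * pathWeight σ τ i s t ξ|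
      ≤ M * Real.exp (S * ∑ k, |ξ k i|) * |t - 0| := by
    rw [← Real.norm_eq_abs (∫ s in (0 : ℝ)..t, _)]
    refine intervalIntegral.norm_integral_le_of_norm_le_const fun s _ => ?_
    rw [norm_mul]
    exact mul_le_mul ((norm_le_pi_norm (b s (X s (pathShift σ τ i s t ξ))) i).trans (hM _ _))
      (hW s) (norm_nonneg _) hM0
  rw [hX]
  refine (abs_add_le _ _).trans ?_
  rw [abs_mul]
  rw [sub_zero, abs_of_nonneg ht.1] at hint
  have h1 := mul_le_mul_of_nonneg_left (hW 0) (abs_nonneg (c i))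
  have h2 : M * Real.exp (S * ∑ k, |ξ k i|) * t ≤ M * Real.exp (S * ∑ k, |ξ k i|) * T :=
    mul_le_mul_of_nonneg_left ht.2 (by positivity)
  linarith

end Noise

end WickWZ

end

theorem theorem1p1 (T : ℝ) (hT : 0 < T) (d : ℕ)
    (b : ℝ → (Fin d → ℝ) → Fin d → ℝ) (σ : Fin d → ℝ → ℝ) (c : Fin d → ℝ)
    (hbσ : WickWZ.RegularCoefficients T b σ)
    (P : MeasureTheory.Measure (WickWZ.PathSpace T d)) (hP : WickWZ.IsWienerMeasure P)
    (N : ℕ) (τ : Fin (N + 1) → ℝ) (hτ : WickWZ.IsPartition T τ) :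
    ∃ X : ℝ → WickWZ.PathSpace T d → Fin d → ℝ,
      WickWZ.IsMildSolution P τ b σ c X ∧
      ∃ u : Fin N → (Fin d → ℝ) → ℝ → (Fin d → ℝ) → Fin d → ℝ,
        (∀ k α, WickWZ.IsClassicalSolution b σ (WickWZ.len τ k) (τ k.castSucc) (τ k.succ) α
          (u k α)) ∧
        (∀ ω, X 0 ω = c) ∧
        (∀ k, ∀ t ∈ Set.Icc (τ k.castSucc) (τ k.succ), ∀ ω,
          X t ω = u k (X (τ k.castSucc) ω) t
            (WickWZ.B (τ k.succ) ω - WickWZ.B (τ k.castSucc) ω)) := by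
  open WickWZ in
  obtain ⟨b₁, b', ς, S, hb, hb₁, hς, M, hM⟩ := hbσ.exists_global hT
  have hex := fun k : Fin N => hb.exists_isMildPDESolution (len τ k) (τ k.castSucc)
  choose u hu hmild using hex
  have hcl : ∀ k α, IsClassicalSolution b σ (len τ k) (τ k.castSucc) (τ k.succ) α (u k α) :=
    fun k α => hb.isClassicalSolution hb₁ hς (hτ.mem_Icc _).1
      (hτ.strictMono Fin.castSucc_lt_succ) (hτ.mem_Icc _).2
      ((hu k).comp (by fun_prop : Continuous fun q : ℝ × (Fin d → ℝ) => (α, q.1, q.2)))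
      (hmild k α)
  have hu0 : ∀ k α x, u k α (τ k.castSucc) x = α := fun k α => (hcl k α).initial
  have hcont := continuous_partialState (τ := τ) (c := c) hu N
  have hmildX : ∀ t ∈ Set.Icc 0 T, ∀ ξ i, state u τ c t ξ i = c i * pathWeight ς τ i 0 t ξ +
      ∫ s in (0 : ℝ)..t,
        b₁ s (state u τ c s (pathShift ς τ i s t ξ)) i * pathWeight ς τ i s t ξ := by
    have := state_mild (c := c) hb hτ.strictMono hu hmild hu0 (Fin.last N)
    rwa [hτ.zero, hτ.last] at this
  have hmeas : ∀ t, Measurable fun ω : PathSpace T d => state u τ c t (increment τ ω) := fun t =>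
    (hcont.comp (by fun_prop : Continuous fun ξ : Fin N → Fin d → ℝ => (t, ξ))).measurable.comp
      (measurable_increment τ)
  refine ⟨fun t ω => state u τ c t (increment τ ω), ?_, u, hcl, fun ω => ?_, fun k t ht ω => ?_⟩
  · refine ⟨fun t _ => hmeas t, ?_, ⟨2, by norm_num, fun t ht i => ?_⟩, ?_⟩
    · refine MeasureTheory.ae_of_all _ fun ω => Continuous.continuousOn ?_
      exact hcont.comp (by fun_prop : Continuous fun t : ℝ => (t, increment τ ω))
    · refine ((hP.memLp_exp hτ i S).const_mul (|c i| + M * T)).mono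
        ((measurable_pi_apply i).comp (hmeas t)).aestronglyMeasurable
        (MeasureTheory.ae_of_all _ fun ω => ?_)
      exact (abs_state_le hb hτ hM ht (hmildX t ht _ i)).trans (le_abs_self _)
    · refine MeasureTheory.ae_of_all _ fun ω t ht i => ?_
      have e : Set.EqOn
          (fun s => b₁ s (state u τ c s (pathShift ς τ i s t (increment τ ω))) i *
            pathWeight ς τ i s t (increment τ ω))
          (fun s => wickMul P τ σ i s t (fun ω' => b s (state u τ c s (increment τ ω')) i) ω)
          (Set.uIcc 0 t) := by
        intro s hs
        rw [Set.uIcc_of_le ht.1] at hs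
        simp only [wickMul]
        rw [increment_sub_shift hb hς hτ i hs.1 hs.2 ht.2,
          wickExp_eq hb hς hτ hP i hs.1 hs.2 ht.2, hb₁ s ⟨hs.1, hs.2.trans ht.2⟩]
      refine ⟨?_, ?_⟩
      · exact ((continuous_mildStateIntegrand hb hu t (increment τ ω) i).intervalIntegrable
          0 t).congr (fun s hs => e (Set.uIoc_subset_uIcc hs))
      · rw [← intervalIntegral.integral_congr e, wickExp_eq hb hς hτ hP i le_rfl ht.1 ht.2]
        exact hmildX t ht _ i
  · have := state_initial (c := c) hτ.strictMono hu0 (increment τ ω)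
    rwa [hτ.zero] at this
  · exact state_eq hτ.strictMono hu0 k ht _
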